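/- Let $\mathcal A$ be a finite alphabet, let $\Sigma\subset\mathcal A^{\mathbb Z}$ be a subshift (a closed subset invariant under the shift and its inverse), and let $\tau$ be the shift on $\Sigma$, $(\tau x)_i=x_{i+1}$. Let $[[\tau]]$ be its topological full group, i.e. the group of all homeomorphisms $g$ of $\Sigma$ such that every $x\in\Sigma$ has an open neighbourhood $U$ and an integer $k$ with $g|_U=\tau^k|_U$. Let $\rho(n)$ be the complexity of $\Sigma$: the number of words of length $n$ that occur in sequences of $\Sigma$. Assume that no point of $\Sigma$ is both isolated in $\Sigma$ and periodic for $\tau$, and that $$\lim_{n\to\infty}\Big(\frac{\log n}{n}\Big)^2\rho(n)=0.$$ (1) For every symmetric, finitely supported probability measure $\mu$ on $[[\tau]]$ there exists a constant $C_1>0$ such that for every $n\ge 1$ the return probabilities satisfy $$\mu^{*2n}(e)\ \ge\ \frac1{C_1}\exp\!\Big(-C_1\,\rho\big(\lceil C_1\sqrt{n\log n}\,\rceil\big)\log n\Big),$$ where $\mu^{*m}$ denotes the $m$-th convolution power of $\mu$ and $e$ is the identity of $[[\tau]]$. (2) Suppose moreover that there exist $C>0$ and $\alpha\in[1,2)$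 such that $\rho(n)\le Cn^\alpha$ for every $n\ge1$. Then for every finitely generated subgroup $G$ of $[[\tau]]$, every finite symmetric generating set $S$ of $G$ and every $\varepsilon>0$, there exists $C_2>0$ such that for every $n\ge1$ there is a nonempty finite set $F\subset G$ with $|\partial_S F|\le\frac1n|F|$, where $\partial_S F=\{g\in F:\exists s\in S,\ sg\notin F\}$, and the Følner function $$\operatorname{F\o l}_{G,S}(n)=\min\{|F| : F\subset G \text{ nonempty and finite},\ |\partial_S F|\le \tfrac1n|F|\}$$ satisfies $$\operatorname{F\o l}_{G,S}(n)\ \le\ C_2\exp\!\big(C_2\,n^{2\alpha/(2-\alpha)+\varepsilon}\big).$$ -/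

import Mathlib

open SymbolicDynamics.FullShift Topology Filter

/-- The topological full group `[[τ]]` of a homeomorphism `τ` of a space `X`: the group of all
homeomorphisms of `X` that locally coincide with a power of `τ`. -/
def topologicalFullGroup {X : Type*} [TopologicalSpace X] (τ : X ≃ₜ X) : Subgroup (X ≃ₜ X) where
  carrier := {g | ∀ x : X, ∃ U : Set X, IsOpen U ∧ x ∈ U ∧ ∃ k : ℤ, ∀ y ∈ U, g y = (τ ^ k) y}
  one_mem' x := ⟨Set.univ, isOpen_univ, trivial, 0, fun y _ => by simp⟩
  mul_mem' := by
    intro g h hg hh x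
    obtain ⟨U, hU, hxU, k, hk⟩ := hh x
    obtain ⟨V, hV, hxV, l, hl⟩ := hg (h x)
    refine ⟨U ∩ h ⁻¹' V, hU.inter (hV.preimage h.continuous), ⟨hxU, hxV⟩, l + k, ?_⟩
    rintro y ⟨hyU, hyV⟩
    rw [zpow_add, Homeomorph.mul_apply, Homeomorph.mul_apply, hl _ hyV, hk _ hyU]
  inv_mem' := by
    intro g hg x
    obtain ⟨U, hU, hxU, k, hk⟩ := hg (g⁻¹ x)
    refine ⟨⇑(g⁻¹) ⁻¹' U, hU.preimage (g⁻¹).continuous, hxU, -k, fun y hy => ?_⟩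
    have h1 : g (g⁻¹ y) = (τ ^ k) (g⁻¹ y) := hk _ hy
    have h2 : g (g⁻¹ y) = y := g.apply_symm_apply y
    have h3 : (τ ^ (-k)) ((τ ^ k) (g⁻¹ y)) = g⁻¹ y := by
      rw [← Homeomorph.mul_apply, ← zpow_add]; simp
    rw [← h3, ← h1, h2]

namespace SymbolicDynamics.FullShift.Subshift

variable {A : Type*} [TopologicalSpace A]

/-- The left shift `(τ x) i = x (i + 1)`, as a homeomorphism of the subshift `Y`. -/
def shiftHomeo (Y : Subshift A ℤ) : Y.carrier ≃ₜ Y.carrier where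
  toFun x := ⟨shift 1 x.1, Y.mapsTo 1 x.2⟩
  invFun x := ⟨shift (-1) x.1, Y.mapsTo (-1) x.2⟩
  left_inv x := by ext i; simp
  right_inv x := by ext i; simp
  continuous_toFun := by fun_prop
  continuous_invFun := by fun_prop

/-- The word complexity of `Y`: the number of words of length `n` that occur in sequences
of `Y`. -/
noncomputable def complexity (Y : Subshift A ℤ) (n : ℕ) : ℕ :=
  {w : Fin n → A | ∃ x ∈ Y.carrier, ∃ i : ℤ, ∀ j : Fin n, x (i + (j : ℕ)) = w j}.ncard

/-- No point of `Y` is both isolated in `Y` and periodic for the shift. -/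
def NoIsolatedPeriodicPoints (Y : Subshift A ℤ) : Prop :=
  ∀ x : Y.carrier, x ∈ Function.periodicPts Y.shiftHomeo → ¬ IsOpen ({x} : Set Y.carrier)

end SymbolicDynamics.FullShift.Subshift

section RandomWalk

variable {G : Type*} [Group G]

/-- The convolution of two discrete probability measures on a group: the law of the product
`g * h` of independent `g`, `h` with laws `μ`, `ν`. -/
noncomputable def groupConv (μ ν : PMF G) : PMF G := μ.bind fun g => ν.map fun h => g * h

/-- The convolution powers of `μ`; the zeroth one is the Dirac mass at the identity. -/
noncomputable def convPower (μ : PMF G) : ℕ → PMF G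
  | 0 => PMF.pure 1
  | n + 1 => groupConv (convPower μ n) μ

/-- The inner boundary `{g ∈ F : ∃ s ∈ S, s * g ∉ F}`. -/
noncomputable def innerBoundary (S F : Finset G) : Finset G :=
  open Classical in F.filter fun g => ∃ s ∈ S, s * g ∉ F

/-- The cardinalities of the nonempty finite sets `F` with `|∂_S F| ≤ |F| / n`. -/
def foelnerCards (S : Finset G) (n : ℕ) : Set ℕ :=
  {m | ∃ F : Finset G, F.Nonempty ∧ F.card = m ∧
    ((innerBoundary S F).card : ℝ) ≤ 1 / (n : ℝ) * (F.card : ℝ)}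

/-- The Følner function: the smallest element of `foelnerCards S n`. (It is meaningful only if that
set is nonempty, as it is for amenable groups.) -/
noncomputable def foelnerFunction (S : Finset G) (n : ℕ) : ℕ := sInf (foelnerCards S n)

end RandomWalk

/-! For symmetric `μ`, the return probability at time `2n` is the squared `ℓ²` norm of the law at
time `n`, so by Cauchy-Schwarz it is at least `1/(4|E|)` for every finite set `E` carrying half of
that law. The task is to find a small `E`.

Without isolated periodic points, an element of the full group has a well-defined integer
displacement at each point, and the group acts on `ℤ` along every orbit. The displacement performs a
symmetric walk with jumps at most `D`, so the Varopoulos-Carne bound gives it Gaussian tails. At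
time `n` it depends only on a word of length `2nD + 1`; since complexity is at most quadratic for
large lengths, a union bound over words shows that with probability at least `1/2` all displacements
stay below `r`, of order `√(n log n)`, up to time `n`. While they do, the window on which the
displacement depends never exceeds `r + D` (`hasWindow_mul`). Such an element is a map from words of
length `2(r + D) + 1` to `[-r, r]`, which bounds `|E|` and proves (1).

For (2), slow decay of the norms yields a time at which one step hardly decreases the norm; by the
variance identity, the law is then almost invariant under each generator. Truncating it bounds its
support in terms of the return probability, and a superlevel set of its square is a Følner set.
Under polynomial complexity the return probability is at least `exp (-K n^β)` with `β` slightly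
above `α/2`, and optimizing the time gives the exponent `2β/(1-β)`, close to `2α/(2-α)`. -/

/-! ### The inner product on finitely supported functions -/

section DotForm

variable {Ω : Type*}

/-- The bilinear form `∑ i, f i * g i` on finitely supported functions. -/
noncomputable def dotForm (Ω : Type*) : LinearMap.BilinForm ℝ (Ω →₀ ℝ) :=
  Finsupp.bilinearCombination ℝ ℝ ∘ₗ Finsupp.lcoeFun

lemma dotForm_eq_sum_of_subset (f g : Ω →₀ ℝ) {s : Finset Ω} (hs : g.support ⊆ s) :
    dotForm Ω f g = ∑ i ∈ s, f i * g i := by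
  rw [show dotForm Ω f g = g.sum fun i a => a • f i from rfl,
    Finsupp.sum_of_support_subset g hs _ (by simp)]
  exact Finset.sum_congr rfl fun i _ => by rw [smul_eq_mul, mul_comm]

lemma dotForm_comm (f g : Ω →₀ ℝ) : dotForm Ω f g = dotForm Ω g f := by
  classical
  rw [dotForm_eq_sum_of_subset f g (Finset.subset_union_right (s₁ := f.support)),
    dotForm_eq_sum_of_subset g f (Finset.subset_union_left (s₂ := g.support))]
  exact Finset.sum_congr rfl fun i _ => mul_comm _ _

lemma dotForm_self_eq_sum (f : Ω →₀ ℝ) {s : Finset Ω} (hs : f.support ⊆ s) :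
    dotForm Ω f f = ∑ i ∈ s, f i ^ 2 := by
  rw [dotForm_eq_sum_of_subset f f hs]
  exact Finset.sum_congr rfl fun i _ => (sq _).symm

lemma dotForm_self_nonneg (f : Ω →₀ ℝ) : 0 ≤ dotForm Ω f f := by
  rw [dotForm_self_eq_sum f subset_rfl]
  positivity

lemma sum_sq_le_dotForm_self (f : Ω →₀ ℝ) (s : Finset Ω) :
    ∑ i ∈ s, f i ^ 2 ≤ dotForm Ω f f := by
  classical
  rw [dotForm_self_eq_sum f (Finset.subset_union_left (s₂ := s))]
  exact Finset.sum_le_sum_of_subset_of_nonneg Finset.subset_union_right fun _ _ _ => sq_nonneg _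

lemma sq_apply_le_dotForm_self (f : Ω →₀ ℝ) (i : Ω) : f i ^ 2 ≤ dotForm Ω f f := by
  simpa using sum_sq_le_dotForm_self f {i}

lemma dotForm_self_mono {f g : Ω →₀ ℝ} (h : ∀ i, |f i| ≤ |g i|) :
    dotForm Ω f f ≤ dotForm Ω g g := by
  rw [dotForm_self_eq_sum f subset_rfl]
  exact (Finset.sum_le_sum fun i _ => sq_le_sq.2 (h i)).trans (sum_sq_le_dotForm_self g _)

lemma dotForm_single_right (f : Ω →₀ ℝ) (i : Ω) (a : ℝ) :
    dotForm Ω f (Finsupp.single i a) = f i * a := by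
  rw [dotForm_eq_sum_of_subset f _ Finsupp.support_single_subset]
  simp

lemma dotForm_mapDomain_left (e : Equiv.Perm Ω) (f g : Ω →₀ ℝ) :
    dotForm Ω (f.mapDomain e) g = dotForm Ω f (g.mapDomain e.symm) := by
  induction g using Finsupp.induction_linear with
  | zero => simp
  | add g₁ g₂ h₁ h₂ => rw [Finsupp.mapDomain_add, map_add, map_add, h₁, h₂]
  | single i a =>
    rw [Finsupp.mapDomain_single, dotForm_single_right, dotForm_single_right,
      Finsupp.mapDomain_equiv_apply]

lemma dotForm_mapDomain_mapDomain (e : Equiv.Perm Ω) (f g : Ω →₀ ℝ) :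
    dotForm Ω (f.mapDomain e) (g.mapDomain e) = dotForm Ω f g := by
  rw [dotForm_mapDomain_left, ← Finsupp.mapDomain_comp]
  simp

end DotForm

/-! ### Markov operators of symmetric random walks -/

section WalkOperator

variable {G Ω : Type*} [Group G]

/-- The Markov operator of the random walk on `Ω` with step distribution `w`, where `G` acts on
`Ω` through `φ`: it maps the law of a random point `i` to that of `φ s i`. -/
noncomputable def walkOp (φ : G →* Equiv.Perm Ω) (w : G →₀ ℝ) : Module.End ℝ (Ω →₀ ℝ) :=
  ∑ s ∈ w.support, w s • Finsupp.lmapDomain ℝ ℝ (φ s)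

lemma walkOp_apply (φ : G →* Equiv.Perm Ω) (w : G →₀ ℝ) (f : Ω →₀ ℝ) :
    walkOp φ w f = ∑ s ∈ w.support, w s • f.mapDomain (φ s) := by
  simp [walkOp, LinearMap.sum_apply, Finsupp.lmapDomain_apply]

/-- A finitely supported symmetric probability distribution on a group. -/
structure IsSymmWeight (w : G →₀ ℝ) : Prop where
  nonneg : ∀ s, 0 ≤ w s
  sum_eq_one : ∑ s ∈ w.support, w s = 1
  inv : ∀ s, w s⁻¹ = w s

variable {φ : G →* Equiv.Perm Ω} {w : G →₀ ℝ}

lemma IsSymmWeight.inv_mem_support (hw : IsSymmWeight w) {s : G} (hs : s ∈ w.support) :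
    s⁻¹ ∈ w.support := by
  rw [Finsupp.mem_support_iff, hw.inv]
  exact Finsupp.mem_support_iff.1 hs

/-- The adjoint of translation by `s` is translation by `s⁻¹`, and `w` gives both the same weight.
-/
lemma IsSymmWeight.dotForm_walkOp_left (hw : IsSymmWeight w) (f g : Ω →₀ ℝ) :
    dotForm Ω (walkOp φ w f) g = dotForm Ω f (walkOp φ w g) := by
  simp only [walkOp_apply, map_sum, LinearMap.sum_apply, map_smul, LinearMap.smul_apply,
    dotForm_mapDomain_left]
  refine Finset.sum_bij' (fun s _ => s⁻¹) (fun s _ => s⁻¹) (fun s hs => hw.inv_mem_support hs)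
    (fun s hs => hw.inv_mem_support hs) (by simp) (by simp) fun s _ => ?_
  rw [hw.inv, map_inv]
  rfl

/-- Translations are isometries, so this is `E‖X - EX‖² = E‖X‖² - ‖EX‖²` for a random translate of
`f`. It gives contractivity here and almost invariance later. -/
lemma IsSymmWeight.dotForm_variance (hw : IsSymmWeight w) (f : Ω →₀ ℝ) :
    ∑ s ∈ w.support, w s * dotForm Ω (f.mapDomain (φ s) - walkOp φ w f)
        (f.mapDomain (φ s) - walkOp φ w f) =
      dotForm Ω f f - dotForm Ω (walkOp φ w f) (walkOp φ w f) := by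
  set u := walkOp φ w f with hu
  have h0 (v : Ω →₀ ℝ) : dotForm Ω (walkOp φ w f) v =
      ∑ s ∈ w.support, w s * dotForm Ω (f.mapDomain (φ s)) v := by
    simp only [walkOp_apply, map_sum, LinearMap.sum_apply, map_smul, LinearMap.smul_apply,
      smul_eq_mul]
  have h1 := (h0 u).symm
  rw [← hu] at h1
  calc _ = ∑ s ∈ w.support, (w s * dotForm Ω f f - 2 * (w s * dotForm Ω (f.mapDomain (φ s)) u)
        + w s * dotForm Ω u u) := by
        refine Finset.sum_congr rfl fun s _ => ?_
        simp only [map_sub, LinearMap.sub_apply, dotForm_mapDomain_mapDomain,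
          dotForm_comm u (f.mapDomain (φ s))]
        ring
    _ = _ := by
        rw [Finset.sum_add_distrib, Finset.sum_sub_distrib, ← Finset.mul_sum, h1,
          ← Finset.sum_mul, ← Finset.sum_mul, hw.sum_eq_one]
        ring

lemma IsSymmWeight.dotForm_walkOp_self_le (hw : IsSymmWeight w) (f : Ω →₀ ℝ) :
    dotForm Ω (walkOp φ w f) (walkOp φ w f) ≤ dotForm Ω f f := by
  have h := hw.dotForm_variance (φ := φ) f
  have : 0 ≤ ∑ s ∈ w.support, w s * dotForm Ω (f.mapDomain (φ s) - walkOp φ w f)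
        (f.mapDomain (φ s) - walkOp φ w f) :=
    Finset.sum_nonneg fun s _ => mul_nonneg (hw.nonneg s) (dotForm_self_nonneg _)
  linarith

lemma IsSymmWeight.dotForm_walkOp_pow_left (hw : IsSymmWeight w) (n : ℕ) (f g : Ω →₀ ℝ) :
    dotForm Ω ((walkOp φ w ^ n) f) g = dotForm Ω f ((walkOp φ w ^ n) g) := by
  induction n generalizing f g with
  | zero => simp
  | succ n ih =>
    rw [pow_succ', Module.End.mul_apply, hw.dotForm_walkOp_left, ih, ← Module.End.mul_apply,
      ← pow_succ, ← pow_succ']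

/-- Used with orbit maps, to project the walk on the group to `ℤ`, and with subgroup inclusions. -/
lemma walkOp_pow_mapDomain {Ω' : Type*} {φ' : G →* Equiv.Perm Ω'} (p : Ω → Ω')
    (hp : ∀ g i, p (φ g i) = φ' g (p i)) (n : ℕ) (f : Ω →₀ ℝ) :
    ((walkOp φ w ^ n) f).mapDomain p = (walkOp φ' w ^ n) (f.mapDomain p) := by
  induction n with
  | zero => simp
  | succ n ih =>
    rw [pow_succ', pow_succ', Module.End.mul_apply, Module.End.mul_apply, ← ih, walkOp_apply,
      walkOp_apply, Finsupp.mapDomain_finsetSum]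
    refine Finset.sum_congr rfl fun s _ => ?_
    rw [Finsupp.mapDomain_smul, ← Finsupp.mapDomain_comp, ← Finsupp.mapDomain_comp,
      show p ∘ φ s = φ' s ∘ p from funext (hp s)]

lemma IsSymmWeight.walkOp_pow_nonneg (hw : IsSymmWeight w) (n : ℕ) {f : Ω →₀ ℝ}
    (hf : ∀ i, 0 ≤ f i) (i : Ω) : 0 ≤ (walkOp φ w ^ n) f i := by
  induction n generalizing i with
  | zero => simpa using hf i
  | succ n ih =>
    rw [pow_succ', Module.End.mul_apply, walkOp_apply, Finsupp.finsetSum_apply]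
    refine Finset.sum_nonneg fun s _ => ?_
    rw [Finsupp.smul_apply, Finsupp.mapDomain_equiv_apply]
    exact mul_nonneg (hw.nonneg s) (ih _)

lemma walkOp_apply_apply (f : Ω →₀ ℝ) (i : Ω) :
    walkOp φ w f i = ∑ s ∈ w.support, w s * f ((φ s).symm i) := by
  rw [walkOp_apply, Finsupp.finsetSum_apply]
  exact Finset.sum_congr rfl fun s _ => by
    rw [Finsupp.smul_apply, Finsupp.mapDomain_equiv_apply, smul_eq_mul]

/-- The total mass is preserved. -/
lemma IsSymmWeight.linearCombination_walkOp_pow (hw : IsSymmWeight w) (n : ℕ) (f : Ω →₀ ℝ) :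
    Finsupp.linearCombination ℝ (fun _ => (1 : ℝ)) ((walkOp φ w ^ n) f) =
      Finsupp.linearCombination ℝ (fun _ => (1 : ℝ)) f := by
  induction n with
  | zero => simp
  | succ n ih =>
    rw [pow_succ', Module.End.mul_apply, walkOp_apply, map_sum, ← ih]
    simp only [map_smul, Finsupp.linearCombination_mapDomain, Function.comp_def]
    rw [← Finset.sum_smul, hw.sum_eq_one, one_smul]

end WalkOperator

/-! ### Chebyshev polynomials and the Varopoulos-Carne bound -/

section VaropoulosCarne

open Polynomial

/-- The polynomial form of `cos² + sin² = 1`; it replaces the spectral theorem in bounding `T_n` of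
the Markov operator. -/
lemma chebyshev_T_sq_add (n : ℤ) :
    Chebyshev.T ℝ n ^ 2 + (1 - X ^ 2) * Chebyshev.U ℝ (n - 1) ^ 2 = 1 := by
  have h := congrArg (fun p : ℝ[X] => p.comp (2 * X)) (Chebyshev.S_sq_add_S_sq ℝ (n - 1))
  simp only [sub_comp, add_comp, mul_comp, pow_comp, X_comp, one_comp, sub_add_cancel,
    Chebyshev.S_comp_two_mul_X] at h
  rw [Chebyshev.T_eq_U_sub_X_mul_U]
  linear_combination h

/-- The expansion of `X ^ n` in Chebyshev polynomials; the coefficients are those of the law of the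
simple random walk on `ℤ`. -/
lemma exists_X_pow_eq_linearCombination_chebyshev_T (n : ℕ) :
    ∃ c : ℤ →₀ ℝ, (∀ k, 0 ≤ c k) ∧
      Finsupp.linearCombination ℝ (Chebyshev.T ℝ) c = X ^ n ∧
      ∀ r : ℝ, Finsupp.linearCombination ℝ (fun k : ℤ => Real.exp (r * k)) c = Real.cosh r ^ n := by
  induction n with
  | zero =>
    refine ⟨Finsupp.single 0 1, fun k => ?_, by simp, by simp⟩
    rw [Finsupp.single_apply]
    split_ifs <;> norm_num
  | succ n ih =>
    obtain ⟨c, hc, hT, hexp⟩ := ih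
    -- One step of the simple walk acts as `L` on any family with this recursion: on `T_k` as
    -- multiplication by `X`, on `exp (r k)` as multiplication by `cosh r`.
    have hcomb {M : Type} [AddCommGroup M] [Module ℝ M] (v v' : ℤ → M) (L : Module.End ℝ M)
        (hv : ∀ k, v (k + 1) + v (k - 1) = (2 : ℝ) • L (v k)) :
        Finsupp.linearCombination ℝ v ((1 / 2 : ℝ) • (c.mapDomain (Equiv.addRight (1 : ℤ)) +
          c.mapDomain (Equiv.addRight (-1 : ℤ)))) = L (Finsupp.linearCombination ℝ v c) := by
      rw [map_smul, map_add, Finsupp.linearCombination_mapDomain,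
        Finsupp.linearCombination_mapDomain]
      simp only [Finsupp.linearCombination_apply, Finsupp.sum, ← Finset.sum_add_distrib, ← smul_add,
        Function.comp_apply, Equiv.coe_addRight, map_sum, map_smul, Finset.smul_sum]
      refine Finset.sum_congr rfl fun k _ => ?_
      rw [← sub_eq_add_neg, hv, smul_comm (c k) (2 : ℝ), smul_smul]
      norm_num
    refine ⟨(1 / 2 : ℝ) • (c.mapDomain (Equiv.addRight (1 : ℤ)) +
          c.mapDomain (Equiv.addRight (-1 : ℤ))), fun k => ?_, ?_, fun r => ?_⟩
    · rw [Finsupp.smul_apply, Finsupp.add_apply, Finsupp.mapDomain_equiv_apply,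
        Finsupp.mapDomain_equiv_apply, smul_eq_mul]
      have := hc ((Equiv.addRight (1 : ℤ)).symm k)
      have := hc ((Equiv.addRight (-1 : ℤ)).symm k)
      positivity
    · rw [hcomb _ (Chebyshev.T ℝ) (LinearMap.mulLeft ℝ X), hT, LinearMap.mulLeft_apply, pow_succ']
      intro k
      rw [LinearMap.mulLeft_apply, Chebyshev.T_add_one, two_smul]
      ring
    · rw [hcomb _ (fun k : ℤ => Real.exp (r * k)) (LinearMap.mulLeft ℝ (Real.cosh r)), hexp,
        LinearMap.mulLeft_apply, pow_succ']
      intro k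
      rw [LinearMap.mulLeft_apply, Real.cosh_eq, smul_eq_mul]
      push_cast
      rw [mul_add, mul_sub, mul_one, Real.exp_add, sub_eq_add_neg, Real.exp_add]
      ring

variable {Ω G : Type*} [Group G] {φ : G →* Equiv.Perm Ω} {w : G →₀ ℝ}

lemma IsSymmWeight.dotForm_aeval_left (hw : IsSymmWeight w) (p : ℝ[X]) (f g : Ω →₀ ℝ) :
    dotForm Ω (aeval (walkOp φ w) p f) g = dotForm Ω f (aeval (walkOp φ w) p g) := by
  induction p using Polynomial.induction_on' with
  | add p q hp hq => simp only [map_add, LinearMap.add_apply, hp, hq]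
  | monomial n a =>
    simp only [aeval_monomial, Module.End.mul_apply, Module.algebraMap_end_apply, map_smul,
      LinearMap.smul_apply, hw.dotForm_walkOp_pow_left]

/-- With `P` the operator and `u = U_{n-1}(P) f`, the identity above reads `‖T_n(P) f‖² + ‖u‖² - ‖P
u‖² = ‖f‖²`, and `P` is a contraction. -/
lemma IsSymmWeight.dotForm_aeval_chebyshev_T_le (hw : IsSymmWeight w) (n : ℤ) (f : Ω →₀ ℝ) :
    dotForm Ω (aeval (walkOp φ w) (Chebyshev.T ℝ n) f) (aeval (walkOp φ w) (Chebyshev.T ℝ n) f) ≤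
      dotForm Ω f f := by
  set u := aeval (walkOp φ w) (Chebyshev.U ℝ (n - 1)) f with hu
  have h := congrArg (fun p => dotForm Ω f (aeval (walkOp φ w) p f)) (chebyshev_T_sq_add n)
  have hX : aeval (walkOp φ w) (X ^ 2 * Chebyshev.U ℝ (n - 1) ^ 2) f =
      aeval (walkOp φ w) (Chebyshev.U ℝ (n - 1)) (walkOp φ w (walkOp φ w u)) := by
    rw [show (X ^ 2 * Chebyshev.U ℝ (n - 1) ^ 2 : ℝ[X]) =
      Chebyshev.U ℝ (n - 1) * (X * (X * Chebyshev.U ℝ (n - 1))) by ring]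
    simp [Module.End.mul_apply, hu]
  simp only [sub_mul, one_mul, map_add, map_sub, LinearMap.add_apply, LinearMap.sub_apply, hX,
    map_one, Module.End.one_apply] at h
  simp only [map_mul, sq, Module.End.mul_apply, ← hw.dotForm_aeval_left, ← hu] at h
  rw [← hw.dotForm_walkOp_left] at h
  rw [hw.dotForm_aeval_left, dotForm_comm]
  have := hw.dotForm_walkOp_self_le (φ := φ) u
  linarith

lemma walkOp_apply_eq_zero {φ : G →* Equiv.Perm ℤ} {D m : ℤ}
    (hD : ∀ s ∈ w.support, ∀ i, |φ s i - i| ≤ D) {f : ℤ →₀ ℝ} (hf : ∀ i, m < |i| → f i = 0)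
    {i : ℤ} (hi : m + D < |i|) : walkOp φ w f i = 0 := by
  rw [walkOp_apply_apply]
  refine Finset.sum_eq_zero fun s hs => ?_
  have h := hD s hs ((φ s).symm i)
  rw [Equiv.apply_symm_apply] at h
  rw [hf, mul_zero]
  have := abs_sub_abs_le_abs_sub i ((φ s).symm i)
  omega

lemma walkOp_pow_single_eq_zero {φ : G →* Equiv.Perm ℤ} {D : ℤ}
    (hD : ∀ s ∈ w.support, ∀ i, |φ s i - i| ≤ D) (n : ℕ) :
    ∀ i, n * D < |i| → (walkOp φ w ^ n) (Finsupp.single 0 1) i = 0 := by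
  induction n with
  | zero =>
    intro i hi
    have : i ≠ 0 := by rintro rfl; simp at hi
    simp [this.symm]
  | succ n ih =>
    intro i hi
    rw [pow_succ', Module.End.mul_apply]
    refine walkOp_apply_eq_zero hD ih ?_
    push_cast at hi
    linarith

lemma aeval_walkOp_single_eq_zero {φ : G →* Equiv.Perm ℤ} {D : ℤ} (hD₀ : 0 ≤ D)
    (hD : ∀ s ∈ w.support, ∀ i, |φ s i - i| ≤ D) (p : ℝ[X]) {i : ℤ}
    (hi : p.natDegree * D < |i|) : aeval (walkOp φ w) p (Finsupp.single 0 1) i = 0 := by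
  rw [aeval_eq_sum_range, LinearMap.sum_apply, Finsupp.finsetSum_apply]
  refine Finset.sum_eq_zero fun n hn => ?_
  have hn' : (n : ℤ) ≤ p.natDegree := by
    have := Finset.mem_range.1 hn
    omega
  rw [LinearMap.smul_apply, Finsupp.smul_apply, walkOp_pow_single_eq_zero hD n i
    ((mul_le_mul_of_nonneg_right hn' hD₀).trans_lt hi), smul_zero]

/-- The Varopoulos-Carne bound for symmetric random walks on `ℤ` with bounded jumps. -/
theorem IsSymmWeight.abs_walkOp_pow_single_le (hw : IsSymmWeight w) {φ : G →* Equiv.Perm ℤ} {D : ℤ}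
    (hD₀ : 0 < D) (hD : ∀ s ∈ w.support, ∀ i, |φ s i - i| ≤ D) {n : ℕ} (hn : n ≠ 0) (i : ℤ) :
    |(walkOp φ w ^ n) (Finsupp.single 0 1) i| ≤
      2 * Real.exp (-((i : ℝ) ^ 2 / (2 * (D : ℝ) ^ 2 * n))) := by
  obtain ⟨c, hc, hT, hexp⟩ := exists_X_pow_eq_linearCombination_chebyshev_T n
  have hD' : (0 : ℝ) < D := by exact_mod_cast hD₀
  have hn' : (0 : ℝ) < n := by positivity
  set t : ℝ := |(i : ℝ)| / D with ht
  -- The Chernoff parameter: it minimizes `-r t + n r² / 2`, with value `-t² / (2n)`.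
  set r : ℝ := t / n with hr
  have ht0 : 0 ≤ t := by positivity
  have hr0 : 0 ≤ r := by positivity
  -- `T_k` of the operator has propagation `|k| D`, hence vanishes at `i` if `|k| < t`; otherwise
  -- its value is at most `1`, and so is dominated by the right side.
  have key (k : ℤ) : |aeval (walkOp φ w) (Chebyshev.T ℝ k) (Finsupp.single 0 1) i| ≤
      Real.exp (-(r * t)) * (Real.exp (r * k) + Real.exp (-r * k)) := by
    by_cases hk : (k.natAbs : ℤ) * D < |i|
    · rw [aeval_walkOp_single_eq_zero hD₀.le hD, abs_zero]
      · positivity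
      · rwa [Chebyshev.natDegree_T]
    · have h1 : |aeval (walkOp φ w) (Chebyshev.T ℝ k) (Finsupp.single 0 1) i| ≤ 1 := by
        rw [← sq_le_one_iff_abs_le_one]
        refine (sq_apply_le_dotForm_self _ i).trans
          ((hw.dotForm_aeval_chebyshev_T_le k _).trans ?_)
        rw [dotForm_single_right]
        simp
      refine h1.trans ?_
      have hk' : t ≤ |(k : ℝ)| := by
        rw [ht, div_le_iff₀ hD']
        have : |i| ≤ |k| * D := by rw [Int.abs_eq_natAbs k]; exact not_lt.1 hk
        exact_mod_cast this
      have h2 : Real.exp (r * t) ≤ Real.exp (r * k) + Real.exp (-r * k) := by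
        have : Real.exp (r * t) ≤ Real.exp (r * |(k : ℝ)|) := by gcongr
        refine this.trans ?_
        rcases abs_cases (k : ℝ) with ⟨h, _⟩ | ⟨h, _⟩
        · rw [h]; linarith [Real.exp_pos (-r * k)]
        · rw [h, mul_neg, ← neg_mul]; linarith [Real.exp_pos (r * k)]
      calc (1 : ℝ) = Real.exp (-(r * t)) * Real.exp (r * t) := by rw [← Real.exp_add]; simp
        _ ≤ _ := by gcongr
  have hP : (walkOp φ w ^ n) (Finsupp.single 0 1) i =
      c.sum fun k a => a * aeval (walkOp φ w) (Chebyshev.T ℝ k) (Finsupp.single 0 1) i := by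
    have h := congrArg (fun p => aeval (walkOp φ w) p (Finsupp.single 0 1) i) hT
    simp only [map_pow, aeval_X] at h
    rw [← h, Finsupp.linearCombination_apply, Finsupp.sum, Finsupp.sum, map_sum,
      LinearMap.sum_apply, Finsupp.finsetSum_apply]
    exact Finset.sum_congr rfl fun k _ => by
      rw [map_smul, LinearMap.smul_apply, Finsupp.smul_apply, smul_eq_mul]
  have hsum (r : ℝ) : ∑ k ∈ c.support, c k * Real.exp (r * k) = Real.cosh r ^ n := hexp r
  calc |(walkOp φ w ^ n) (Finsupp.single 0 1) i|
      ≤ ∑ k ∈ c.support, c k * (Real.exp (-(r * t)) * (Real.exp (r * k) + Real.exp (-r * k))) := by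
        rw [hP, Finsupp.sum]
        refine (Finset.abs_sum_le_sum_abs _ _).trans (Finset.sum_le_sum fun k _ => ?_)
        rw [abs_mul, abs_of_nonneg (hc k)]
        exact mul_le_mul_of_nonneg_left (key k) (hc k)
    _ = 2 * (Real.exp (-(r * t)) * Real.cosh r ^ n) := by
        simp only [mul_left_comm (c _), mul_add, Finset.sum_add_distrib, ← Finset.mul_sum, hsum,
          Real.cosh_neg]
        ring
    _ ≤ 2 * (Real.exp (-(r * t)) * Real.exp (r ^ 2 / 2) ^ n) := by
        have := Real.cosh_le_exp_half_sq r
        have := (Real.cosh_pos r).le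
        gcongr
    _ = _ := by
        rw [← Real.exp_nat_mul, ← Real.exp_add]
        congr 2
        rw [hr, ht]
        field_simp
        rw [sq_abs]
        ring

end VaropoulosCarne

/-! ### Convolution powers as powers of a Markov operator -/

section Weight

variable {G : Type*}

/-- The finitely supported real-valued function given by a finitely supported distribution. -/
noncomputable def PMF.toWeight (μ : PMF G) (hμ : μ.support.Finite) : G →₀ ℝ :=
  Finsupp.ofSupportFinite (fun g => (μ g).toReal) (hμ.subset fun g hg => by
    rw [PMF.mem_support_iff]
    rintro h
    simp [h] at hg)

lemma PMF.toWeight_apply (μ : PMF G) (hμ : μ.support.Finite) (g : G) :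
    μ.toWeight hμ g = (μ g).toReal := rfl

lemma PMF.mem_support_toWeight (μ : PMF G) (hμ : μ.support.Finite) (g : G) :
    g ∈ (μ.toWeight hμ).support ↔ g ∈ μ.support := by
  rw [Finsupp.mem_support_iff, PMF.toWeight_apply, ENNReal.toReal_ne_zero, PMF.mem_support_iff]
  exact and_iff_left (μ.apply_ne_top g)

lemma PMF.tsum_mul_toReal (μ : PMF G) (hμ : μ.support.Finite) (f : G → ENNReal)
    (hf : ∀ g, f g ≠ ⊤) :
    (∑' g, μ g * f g).toReal = ∑ g ∈ (μ.toWeight hμ).support, μ.toWeight hμ g * (f g).toReal := by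
  rw [tsum_eq_sum (s := (μ.toWeight hμ).support), ENNReal.toReal_sum]
  · simp [ENNReal.toReal_mul, PMF.toWeight_apply]
  · exact fun g _ => ENNReal.mul_ne_top (μ.apply_ne_top g) (hf g)
  · intro g hg
    rw [PMF.mem_support_toWeight, PMF.mem_support_iff, not_not] at hg
    rw [hg, zero_mul]

end Weight

section ConvolutionPowers

variable {G : Type*} [Group G]

lemma groupConv_apply (μ ν : PMF G) (g : G) :
    groupConv μ ν g = ∑' a, μ a * ν (a⁻¹ * g) := by
  classical
  rw [groupConv, PMF.bind_apply]
  refine tsum_congr fun a => ?_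
  rw [PMF.map_apply, tsum_eq_single (a⁻¹ * g)]
  · simp
  · intro b hb
    rw [if_neg]
    rintro rfl
    simp at hb

lemma groupConv_assoc (μ ν ξ : PMF G) :
    groupConv (groupConv μ ν) ξ = groupConv μ (groupConv ν ξ) := by
  simp only [groupConv, PMF.bind_bind, PMF.bind_map, PMF.map_bind, PMF.map_comp, Function.comp_def,
    mul_assoc]

/-- `convPower` appends the new factor on the right, whereas the Markov operator multiplies on the
left. -/
lemma convPower_succ' (μ : PMF G) (n : ℕ) :
    convPower μ (n + 1) = groupConv μ (convPower μ n) := by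
  induction n with
  | zero =>
    simp only [convPower, groupConv, PMF.pure_bind, one_mul, PMF.pure_map, mul_one, PMF.bind_pure]
    exact PMF.map_id μ
  | succ n ih => rw [convPower, ih, groupConv_assoc, ← ih]; rfl

lemma PMF.isSymmWeight_toWeight (μ : PMF G) (hμ : μ.support.Finite) (hs : ∀ g, μ g⁻¹ = μ g) :
    IsSymmWeight (μ.toWeight hμ) where
  nonneg _ := ENNReal.toReal_nonneg
  sum_eq_one := by
    have h := μ.tsum_mul_toReal hμ (fun _ => 1) (by simp)
    simpa [μ.tsum_coe] using h.symm
  inv s := by rw [PMF.toWeight_apply, hs, PMF.toWeight_apply]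

lemma convPower_toReal (μ : PMF G) (hμ : μ.support.Finite) (n : ℕ) (g : G) :
    (convPower μ n g).toReal =
      (walkOp (MulAction.toPermHom G G) (μ.toWeight hμ) ^ n) (Finsupp.single 1 1) g := by
  classical
  induction n generalizing g with
  | zero =>
    rw [convPower, PMF.pure_apply, pow_zero, Module.End.one_apply, Finsupp.single_apply]
    by_cases h : g = 1
    · simp [h]
    · simp [h, Ne.symm h]
  | succ n ih =>
    rw [convPower_succ', groupConv_apply, μ.tsum_mul_toReal hμ _ fun a => PMF.apply_ne_top _ _,
      pow_succ', Module.End.mul_apply, walkOp_apply_apply]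
    refine Finset.sum_congr rfl fun a _ => ?_
    rw [ih]
    rfl

lemma convPower_two_mul_toReal (μ : PMF G) (hμ : μ.support.Finite) (hs : ∀ g, μ g⁻¹ = μ g)
    (n : ℕ) : (convPower μ (2 * n) 1).toReal =
      dotForm G ((walkOp (MulAction.toPermHom G G) (μ.toWeight hμ) ^ n) (Finsupp.single 1 1))
        ((walkOp (MulAction.toPermHom G G) (μ.toWeight hμ) ^ n) (Finsupp.single 1 1)) := by
  rw [(μ.isSymmWeight_toWeight hμ hs).dotForm_walkOp_pow_left, ← Module.End.mul_apply, ← pow_add,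
    ← two_mul, dotForm_comm, dotForm_single_right, mul_one, convPower_toReal μ hμ]

end ConvolutionPowers

/-! ### Mass of sets under the law of the walk -/

section Mass

variable {G : Type*}

/-- The mass that a finitely supported function gives to a set. -/
noncomputable def massOf (E : Set G) : (G →₀ ℝ) →ₗ[ℝ] ℝ :=
  Finsupp.linearCombination ℝ (E.indicator 1)

lemma massOf_apply (E : Set G) (f : G →₀ ℝ) :
    massOf E f = ∑ g ∈ f.support, f g * E.indicator 1 g := by
  simp [massOf, Finsupp.linearCombination_apply, Finsupp.sum]

open Classical in
lemma massOf_eq_sum_filter (E : Set G) (f : G →₀ ℝ) :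
    massOf E f = ∑ g ∈ f.support with g ∈ E, f g := by
  rw [massOf_apply, Finset.sum_filter]
  refine Finset.sum_congr rfl fun g _ => ?_
  by_cases h : g ∈ E <;> simp [h]

lemma massOf_mono {f : G →₀ ℝ} (hf : ∀ g, 0 ≤ f g) {E E' : Set G}
    (h : ∀ g ∈ f.support, g ∈ E → g ∈ E') : massOf E f ≤ massOf E' f := by
  classical
  rw [massOf_eq_sum_filter, massOf_eq_sum_filter]
  refine Finset.sum_le_sum_of_subset_of_nonneg (fun g hg => ?_) fun g _ _ => hf g
  rw [Finset.mem_filter] at hg ⊢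
  exact ⟨hg.1, h g hg.1 hg.2⟩

lemma massOf_iUnion_le {ι : Type*} {f : G →₀ ℝ} (hf : ∀ g, 0 ≤ f g) (t : Finset ι)
    (E : ι → Set G) : massOf {g | ∃ i ∈ t, g ∈ E i} f ≤ ∑ i ∈ t, massOf (E i) f := by
  simp only [massOf_apply]
  rw [Finset.sum_comm]
  refine Finset.sum_le_sum fun g _ => ?_
  rw [← Finset.mul_sum]
  refine mul_le_mul_of_nonneg_left ?_ (hf g)
  by_cases h : ∃ i ∈ t, g ∈ E i
  · obtain ⟨i, hi, hg⟩ := h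
    refine le_trans ?_ (Finset.single_le_sum (f := fun i => (E i).indicator (1 : G → ℝ) g)
      (fun j _ => Set.indicator_nonneg (fun _ _ => zero_le_one) g) hi)
    rw [Set.indicator_of_mem hg]
    exact Set.indicator_le_self' (fun _ _ => zero_le_one) g
  · rw [Set.indicator_of_notMem (by exact h)]
    exact Finset.sum_nonneg fun j _ => Set.indicator_nonneg (fun _ _ => zero_le_one) g

lemma massOf_union_le {f : G →₀ ℝ} (hf : ∀ g, 0 ≤ f g) (E E' : Set G) :
    massOf (E ∪ E') f ≤ massOf E f + massOf E' f := by
  simp only [massOf_apply, ← Finset.sum_add_distrib, ← mul_add]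
  refine Finset.sum_le_sum fun g _ => mul_le_mul_of_nonneg_left ?_ (hf g)
  by_cases h : g ∈ E <;> by_cases h' : g ∈ E' <;> simp [h, h']

lemma massOf_add_massOf_compl (E : Set G) (f : G →₀ ℝ) :
    massOf E f + massOf Eᶜ f = ∑ g ∈ f.support, f g := by
  simp only [massOf_apply, ← Finset.sum_add_distrib, ← mul_add]
  refine Finset.sum_congr rfl fun g _ => ?_
  by_cases h : g ∈ E <;> simp [h]

/-- A set that carries half of the mass at time `n` bounds the return probability at time `2n` from
below. -/
lemma one_le_four_mul_card_mul_dotForm {f : G →₀ ℝ} {E : Set G} (hE : E.Finite)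
    (h : 1 / 2 ≤ massOf E f) : 1 ≤ 4 * (E.ncard : ℝ) * dotForm G f f := by
  classical
  set t := f.support.filter (· ∈ E) with ht
  have h1 : massOf E f = ∑ g ∈ t, f g := massOf_eq_sum_filter E f
  have h2 : (∑ g ∈ t, f g) ^ 2 ≤ t.card * ∑ g ∈ t, f g ^ 2 := sq_sum_le_card_mul_sum_sq
  have h3 : (t.card : ℝ) ≤ E.ncard := by
    rw [← Set.ncard_coe_finset]
    exact_mod_cast Set.ncard_le_ncard (fun g hg => (Finset.mem_filter.1 hg).2) hE
  have h4 : (t.card : ℝ) * ∑ g ∈ t, f g ^ 2 ≤ E.ncard * dotForm G f f :=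
    mul_le_mul h3 (sum_sq_le_dotForm_self f t) (Finset.sum_nonneg fun _ _ => sq_nonneg _)
      (Nat.cast_nonneg _)
  rw [h1] at h
  nlinarith

end Mass

section RandomWalkMass

variable {G : Type*} [Group G]

/-- The law at time `n` of the random walk on `G`, started at the identity and multiplied on the
left by independent increments of law `w`. -/
noncomputable def walkLaw (w : G →₀ ℝ) (n : ℕ) : G →₀ ℝ :=
  (walkOp (MulAction.toPermHom G G) w ^ n) (Finsupp.single 1 1)

variable {w : G →₀ ℝ}

lemma walkLaw_zero : walkLaw w 0 = Finsupp.single 1 1 := rfl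

lemma walkLaw_succ (n : ℕ) :
    walkLaw w (n + 1) = walkOp (MulAction.toPermHom G G) w (walkLaw w n) := by
  rw [walkLaw, walkLaw, pow_succ', Module.End.mul_apply]

lemma IsSymmWeight.walkLaw_nonneg (hw : IsSymmWeight w) (n : ℕ) (g : G) : 0 ≤ walkLaw w n g :=
  hw.walkOp_pow_nonneg n (fun i => by
    classical
    rw [Finsupp.single_apply]; split_ifs <;> norm_num) g

lemma IsSymmWeight.sum_walkLaw (hw : IsSymmWeight w) (n : ℕ) :
    ∑ g ∈ (walkLaw w n).support, walkLaw w n g = 1 := by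
  have h := hw.linearCombination_walkOp_pow (φ := MulAction.toPermHom G G) n (Finsupp.single 1 1)
  rw [← walkLaw] at h
  simpa [Finsupp.linearCombination_apply, Finsupp.sum] using h

/-- A property that holds at time `0` and is preserved by all steps holds on the support of
the law at each time. -/
lemma walkLaw_support_induction (p : ℕ → G → Prop) (h0 : p 0 1)
    (hs : ∀ n, ∀ s ∈ w.support, ∀ g, p n g → p (n + 1) (s * g)) (n : ℕ) {g : G}
    (hg : g ∈ (walkLaw w n).support) : p n g := by
  induction n generalizing g with
  | zero =>
    rw [walkLaw_zero] at hg
    rw [Finset.mem_singleton.1 (Finsupp.support_single_subset hg)]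
    exact h0
  | succ n ih =>
    rw [walkLaw_succ, Finsupp.mem_support_iff, walkOp_apply_apply] at hg
    obtain ⟨s, hs', hne⟩ := Finset.exists_ne_zero_of_sum_ne_zero hg
    have h := hs n s hs' _ (ih (Finsupp.mem_support_iff.2 (right_ne_zero_of_mul hne)))
    simpa using h

lemma massOf_walkLaw_succ (E : Set G) (n : ℕ) :
    massOf E (walkLaw w (n + 1)) =
      ∑ s ∈ w.support, w s * massOf {g | s * g ∈ E} (walkLaw w n) := by
  rw [walkLaw_succ, walkOp_apply, map_sum]
  refine Finset.sum_congr rfl fun s _ => ?_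
  rw [map_smul, massOf, Finsupp.linearCombination_mapDomain, smul_eq_mul]
  rfl

/-- The tail of the displacement on `ℤ` of a symmetric random walk with bounded jumps. -/
lemma IsSymmWeight.massOf_walkLaw_displacement_le (hw : IsSymmWeight w) (φ : G →* Equiv.Perm ℤ)
    {D : ℕ} (hD₀ : 0 < D) (hD : ∀ s ∈ w.support, ∀ i, |φ s i - i| ≤ D) {n : ℕ} (hn : n ≠ 0)
    (r : ℕ) :
    massOf {g | (r : ℤ) < |φ g 0|} (walkLaw w n) ≤
      (2 * (n * D) + 1) * (2 * Real.exp (-((r : ℝ) ^ 2 / (2 * (D : ℝ) ^ 2 * n)))) := by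
  classical
  set f := (walkOp φ w ^ n) (Finsupp.single 0 1) with hf
  -- The orbit map `g ↦ φ g 0` is equivariant, so it sends the walk on `G` to the walk on `ℤ`.
  have hmap : (walkLaw w n).mapDomain (fun g => φ g 0) = f := by
    rw [walkLaw, walkOp_pow_mapDomain (φ' := φ) _ (fun g i => ?_), Finsupp.mapDomain_single]
    · simp [hf]
    · simp
  have h1 : massOf {g | (r : ℤ) < |φ g 0|} (walkLaw w n) =
      ∑ i ∈ f.support, f i * ({i | (r : ℤ) < |i|} : Set ℤ).indicator 1 i := by
    rw [massOf, show (({g | (r : ℤ) < |φ g 0|} : Set G).indicator 1 : G → ℝ) =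
      ({i | (r : ℤ) < |i|} : Set ℤ).indicator 1 ∘ fun g => φ g 0 from rfl,
      ← Finsupp.linearCombination_mapDomain, hmap]
    simp [Finsupp.linearCombination_apply, Finsupp.sum]
  have hsupp : f.support ⊆ Finset.Icc (-((n * D : ℕ) : ℤ)) ((n * D : ℕ) : ℤ) := by
    intro i hi
    rw [Finset.mem_Icc, ← abs_le]
    by_contra hlt
    refine Finsupp.mem_support_iff.1 hi (walkOp_pow_single_eq_zero hD n i ?_)
    push_cast at hlt
    exact not_le.1 hlt
  have hcard : ((f.support.card : ℕ) : ℝ) ≤ 2 * (n * D) + 1 := by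
    have h := Finset.card_le_card hsupp
    rw [Int.card_Icc] at h
    have h' : f.support.card ≤ 2 * (n * D) + 1 := by omega
    exact_mod_cast h'
  rw [h1]
  calc _ ≤ ∑ i ∈ f.support, 2 * Real.exp (-((r : ℝ) ^ 2 / (2 * (D : ℝ) ^ 2 * n))) := by
        refine Finset.sum_le_sum fun i _ => ?_
        by_cases hi : (r : ℤ) < |i|
        · rw [Set.indicator_of_mem (by exact hi), Pi.one_apply, mul_one]
          refine (le_abs_self _).trans ((hw.abs_walkOp_pow_single_le (by exact_mod_cast hD₀) hD hn
            i).trans ?_)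
          have hri : (r : ℝ) ^ 2 ≤ (i : ℝ) ^ 2 := by
            rw [← sq_abs (i : ℝ)]
            have : (r : ℝ) ≤ |(i : ℝ)| := by exact_mod_cast hi.le
            gcongr
          push_cast
          gcongr
        · rw [Set.indicator_of_notMem (by exact hi), mul_zero]
          positivity
    _ ≤ _ := by
        rw [Finset.sum_const, nsmul_eq_mul]
        gcongr

end RandomWalkMass

/-! ### From return probabilities to Følner sets -/

section LayerCake

lemma intervalIntegrable_indicator_le (a M : ℝ) :
    IntervalIntegrable (Set.indicator {x : ℝ | x ≤ a} fun _ => (1 : ℝ)) MeasureTheory.volume 0 M :=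
  Antitone.intervalIntegrable fun x y hxy => by
    by_cases hy : y ≤ a
    · rw [Set.indicator_of_mem (by exact hy), Set.indicator_of_mem (by exact hxy.trans hy)]
    · rw [Set.indicator_of_notMem (by exact hy)]
      exact Set.indicator_nonneg (fun _ _ => zero_le_one) x

lemma integral_indicator_le {a M : ℝ} (ha : 0 ≤ a) (hM : a ≤ M) :
    ∫ t in (0 : ℝ)..M, Set.indicator {x : ℝ | x ≤ a} (fun _ => (1 : ℝ)) t = a := by
  rw [intervalIntegral.integral_indicator ⟨ha, hM⟩]
  simp

variable {G : Type*} [Group G]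

/-- A nonnegative function with small total variation has a superlevel set with small boundary. -/
lemma exists_innerBoundary_card_le (S : Finset G) (v : G →₀ ℝ) (hv : ∀ g, 0 ≤ v g) (hv0 : v ≠ 0)
    {K : ℝ} (hK : ∑ s ∈ S, ∑ g ∈ v.support, (v g - min (v g) (v (s * g))) ≤
      K * ∑ g ∈ v.support, v g) :
    ∃ F : Finset G, F.Nonempty ∧ F ⊆ v.support ∧
      ((innerBoundary S F).card : ℝ) ≤ K * F.card := by
  classical
  obtain ⟨m, hm, hmax⟩ := Finset.exists_max_image v.support v (Finsupp.support_nonempty_iff.2 hv0)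
  have hle (g : G) : v g ≤ v m := by
    by_cases hg : g ∈ v.support
    · exact hmax g hg
    · rw [Finsupp.notMem_support_iff.1 hg]; exact hv m
  have hmpos : 0 < v m := lt_of_le_of_ne (hv m) (Finsupp.mem_support_iff.1 hm).symm
  set I : ℝ → ℝ → ℝ := fun a => Set.indicator {x : ℝ | x ≤ a} fun _ => (1 : ℝ) with hI
  have hint (a : ℝ) : IntervalIntegrable (I a) MeasureTheory.volume 0 (v m) :=
    intervalIntegrable_indicator_le a _
  have hval {a : ℝ} (ha : 0 ≤ a) (hM : a ≤ v m) : ∫ t in (0 : ℝ)..(v m), I a t = a :=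
    integral_indicator_le ha hM
  -- For `t > 0`, `p t` is the size of the superlevel set `{v ≥ t}` and `q t` bounds its boundary;
  -- their integrals are the mass and the variation of `v`.
  set p : ℝ → ℝ := fun t => ∑ g ∈ v.support, I (v g) t with hp
  set q : ℝ → ℝ := fun t =>
    ∑ s ∈ S, ∑ g ∈ v.support, (I (v g) t - I (min (v g) (v (s * g))) t) with hq
  have hpint : IntervalIntegrable p MeasureTheory.volume 0 (v m) := by
    rw [show p = ∑ g ∈ v.support, I (v g) by funext t; simp [hp]]
    exact IntervalIntegrable.sum _ fun g _ => hint _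
  have hqint1 (s : G) : IntervalIntegrable
      (fun t => ∑ g ∈ v.support, (I (v g) t - I (min (v g) (v (s * g))) t))
      MeasureTheory.volume 0 (v m) := by
    rw [show (fun t => ∑ g ∈ v.support, (I (v g) t - I (min (v g) (v (s * g))) t)) =
      ∑ g ∈ v.support, (I (v g) - I (min (v g) (v (s * g)))) by funext t; simp]
    exact IntervalIntegrable.sum _ fun g _ => (hint _).sub (hint _)
  have hqint : IntervalIntegrable q MeasureTheory.volume 0 (v m) := by
    rw [show q = ∑ s ∈ S, fun t => ∑ g ∈ v.support,
      (I (v g) t - I (min (v g) (v (s * g))) t) by funext t; simp [hq]]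
    exact IntervalIntegrable.sum _ fun s _ => hqint1 s
  have hpval : ∫ t in (0 : ℝ)..(v m), p t = ∑ g ∈ v.support, v g := by
    rw [intervalIntegral.integral_finsetSum fun g _ => hint _]
    exact Finset.sum_congr rfl fun g _ => hval (hv g) (hle g)
  have hqval : ∫ t in (0 : ℝ)..(v m), q t =
      ∑ s ∈ S, ∑ g ∈ v.support, (v g - min (v g) (v (s * g))) := by
    rw [intervalIntegral.integral_finsetSum fun s _ => hqint1 s]
    refine Finset.sum_congr rfl fun s _ => ?_
    rw [intervalIntegral.integral_finsetSum fun g _ => (hint _).sub (hint _)]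
    refine Finset.sum_congr rfl fun g _ => ?_
    rw [intervalIntegral.integral_sub (hint _) (hint _), hval (hv g) (hle g),
      hval (le_min (hv _) (hv _)) ((min_le_left _ _).trans (hle g))]
  by_contra! hcon
  have hpos : 0 < ∫ t in (0 : ℝ)..(v m), (q t - K * p t) := by
    refine intervalIntegral.intervalIntegral_pos_of_pos_on (hqint.sub (hpint.const_mul K))
      (fun t ht => ?_) hmpos
    set F := v.support.filter fun g => t ≤ v g with hF
    have hFp : (F.card : ℝ) = p t := by
      rw [hF, Finset.card_filter, hp]
      push_cast
      exact Finset.sum_congr rfl fun g _ => by simp [hI, Set.indicator_apply]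
    have hFq : ((innerBoundary S F).card : ℝ) ≤ q t := by
      have hsub : innerBoundary S F ⊆ S.biUnion fun s =>
          v.support.filter fun g => t ≤ v g ∧ ¬ t ≤ v (s * g) := by
        intro g hg
        rw [innerBoundary, Finset.mem_filter] at hg
        obtain ⟨hgF, s, hs, hsg⟩ := hg
        rw [hF, Finset.mem_filter] at hgF hsg
        rw [Finset.mem_biUnion]
        refine ⟨s, hs, Finset.mem_filter.2 ⟨hgF.1, hgF.2, fun h => hsg ⟨?_, h⟩⟩⟩
        exact Finsupp.mem_support_iff.2 (ht.1.trans_le h).ne'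
      have hcard := (Finset.card_le_card hsub).trans Finset.card_biUnion_le
      refine (Nat.cast_le.2 hcard).trans ?_
      push_cast
      refine Finset.sum_le_sum fun s _ => ?_
      rw [Finset.card_filter]
      push_cast
      refine Finset.sum_le_sum fun g _ => ?_
      simp only [hI, Set.indicator_apply, Set.mem_ofPred_eq, le_min_iff]
      by_cases h1 : t ≤ v g <;> by_cases h2 : t ≤ v (s * g) <;> simp [h1, h2]
    have hlt := hcon F ⟨m, Finset.mem_filter.2 ⟨hm, ht.2.le⟩⟩ (Finset.filter_subset _ _)
    rw [hFp] at hlt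
    linarith
  rw [intervalIntegral.integral_sub hqint (hpint.const_mul K),
    intervalIntegral.integral_const_mul, hpval, hqval] at hpos
  linarith

end LayerCake

section Foelner

variable {G : Type*} [Group G]

/-- Otherwise every step shrinks `a` by more than the factor `r`, and `a N < r ^ N`. -/
lemma exists_lt_mul_le_of_pow_le (a : ℕ → ℝ) (h0 : a 0 = 1) {r : ℝ} (hr : 0 ≤ r)
    {N : ℕ} (hN : N ≠ 0) (h : r ^ N ≤ a N) : ∃ i < N, r * a i ≤ a (i + 1) := by
  by_contra! hcon
  have key : ∀ i ≤ N, a i ≤ r ^ i ∧ (i ≠ 0 → a i < r ^ i) := by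
    intro i
    induction i with
    | zero => simp [h0]
    | succ i ih =>
      intro hi
      have h1 := hcon i hi
      have h2 : r * a i ≤ r ^ (i + 1) := by
        rw [pow_succ']
        exact mul_le_mul_of_nonneg_left (ih (by omega)).1 hr
      exact ⟨(h1.trans_le h2).le, fun _ => h1.trans_le h2⟩
  exact absurd ((key N le_rfl).2 hN) (not_lt.2 h)

lemma dotForm_add_le {Ω : Type*} (f g : Ω →₀ ℝ) :
    dotForm Ω (f + g) (f + g) ≤ 2 * dotForm Ω f f + 2 * dotForm Ω g g := by
  have h := dotForm_self_nonneg (f - g)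
  simp only [map_sub, map_add, LinearMap.sub_apply, LinearMap.add_apply] at h ⊢
  linarith

variable {w : G →₀ ℝ}

lemma IsSymmWeight.dotForm_walkLaw_pos (hw : IsSymmWeight w) (n : ℕ) :
    0 < dotForm G (walkLaw w n) (walkLaw w n) := by
  refine lt_of_le_of_ne (dotForm_self_nonneg _) fun h => ?_
  have hzero (g : G) : walkLaw w n g = 0 := by
    have := sq_apply_le_dotForm_self (walkLaw w n) g
    rw [← h] at this
    exact pow_eq_zero_iff two_ne_zero |>.1 (le_antisymm this (sq_nonneg _))
  have hsum := hw.sum_walkLaw n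
  rw [Finset.sum_eq_zero fun g _ => hzero g] at hsum
  exact zero_ne_one hsum

/-- If the Markov operator hardly decreases the norm of `h`, then `h` is almost invariant. -/
lemma IsSymmWeight.dotForm_mapDomain_sub_self_le (hw : IsSymmWeight w) {q δ : ℝ} (hq : 0 < q)
    (h1 : q ≤ w 1) {s : G} (hs : q ≤ w s) {Ω : Type*} {φ : G →* Equiv.Perm Ω} {f : Ω →₀ ℝ}
    (hf : (1 - δ) * dotForm Ω f f ≤ dotForm Ω (walkOp φ w f) (walkOp φ w f)) :
    dotForm Ω (f.mapDomain (φ s) - f) (f.mapDomain (φ s) - f) ≤ 4 * δ / q * dotForm Ω f f := by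
  have hvar := hw.dotForm_variance (φ := φ) f
  have key {t : G} (ht : q ≤ w t) : dotForm Ω (f.mapDomain (φ t) - walkOp φ w f)
      (f.mapDomain (φ t) - walkOp φ w f) ≤ δ / q * dotForm Ω f f := by
    have htm : t ∈ w.support := Finsupp.mem_support_iff.2 (hq.trans_le ht).ne'
    have h2 := Finset.single_le_sum (f := fun s => w s * dotForm Ω (f.mapDomain (φ s) - walkOp φ w f)
      (f.mapDomain (φ s) - walkOp φ w f))
      (fun s _ => mul_nonneg (hw.nonneg s) (dotForm_self_nonneg _)) htm
    have h3 := mul_le_mul_of_nonneg_right ht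
      (dotForm_self_nonneg (f.mapDomain (φ t) - walkOp φ w f))
    rw [div_mul_eq_mul_div, le_div_iff₀ hq, mul_comm]
    linarith
  -- The identity has weight at least `q`, so `f` itself is close to its average, as its translate
  -- by `s` is.
  have h3 := key h1
  rw [map_one, Equiv.Perm.coe_one, Finsupp.mapDomain_id] at h3
  have h4 := dotForm_add_le (f.mapDomain (φ s) - walkOp φ w f) (walkOp φ w f - f)
  have h5 : dotForm Ω (walkOp φ w f - f) (walkOp φ w f - f) =
      dotForm Ω (f - walkOp φ w f) (f - walkOp φ w f) := by
    rw [← neg_sub f]; simp only [map_neg, LinearMap.neg_apply, neg_neg]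
  rw [h5, sub_add_sub_cancel] at h4
  have h6 := key hs
  calc _ ≤ _ := h4
    _ ≤ 2 * (δ / q * dotForm Ω f f) + 2 * (δ / q * dotForm Ω f f) := by gcongr
    _ = _ := by ring

/-- An almost invariant function yields a set with small boundary. -/
lemma exists_innerBoundary_card_le_of_almost_invariant (S : Finset G) (u : G →₀ ℝ)
    (hu0 : u ≠ 0) {l : ℝ} (hl : 0 < l)
    (h : ∀ s ∈ S, dotForm G (u.mapDomain (s⁻¹ * ·) - u) (u.mapDomain (s⁻¹ * ·) - u) ≤
      4 * l ^ 2 * dotForm G u u) :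
    ∃ F : Finset G, F.Nonempty ∧ F ⊆ u.support ∧
      ((innerBoundary S F).card : ℝ) ≤ S.card * (4 * l) * F.card := by
  -- Squaring turns `ℓ²` almost invariance into `ℓ¹` almost invariance.
  set v : G →₀ ℝ := u.mapRange (· ^ 2) (by simp) with hv
  have hva (g : G) : v g = u g ^ 2 := by rw [hv, Finsupp.mapRange_apply]
  have hsupp : v.support = u.support := by
    ext g; simp [hva]
  have hv0 : v ≠ 0 := by
    rw [← Finsupp.support_nonempty_iff, hsupp, Finsupp.support_nonempty_iff]
    exact hu0
  rw [← hsupp]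
  refine exists_innerBoundary_card_le S v (fun g => by rw [hva]; positivity) hv0 ?_
  have hsum : ∑ g ∈ v.support, v g = dotForm G u u := by
    rw [hsupp, dotForm_self_eq_sum u subset_rfl]
    exact Finset.sum_congr rfl fun g _ => hva g
  rw [hsum, mul_assoc, ← nsmul_eq_mul]
  refine Finset.sum_le_card_nsmul _ _ _ fun s hs => ?_
  have htr (g : G) : u.mapDomain (s⁻¹ * ·) g = u (s * g) := by
    have h := Finsupp.mapDomain_apply (mul_right_injective s⁻¹) u (s * g)
    simpa using h
  have h1 : ∑ g ∈ u.support, (u (s * g) - u g) ^ 2 ≤ 4 * l ^ 2 * dotForm G u u := by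
    refine le_trans (le_of_eq ?_) ((sum_sq_le_dotForm_self _ u.support).trans (h s hs))
    exact Finset.sum_congr rfl fun g _ => by rw [Finsupp.sub_apply, htr]
  have h2 : ∑ g ∈ u.support, u (s * g) ^ 2 ≤ dotForm G u u := by
    have e : dotForm G u u = dotForm G (u.mapDomain (s⁻¹ * ·)) (u.mapDomain (s⁻¹ * ·)) :=
      (dotForm_mapDomain_mapDomain (Equiv.mulLeft s⁻¹) u u).symm
    rw [e]
    refine le_trans (le_of_eq ?_) (sum_sq_le_dotForm_self _ u.support)
    exact Finset.sum_congr rfl fun g _ => by rw [htr]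
  have h3 : ∑ g ∈ u.support, u g ^ 2 = dotForm G u u := (dotForm_self_eq_sum u subset_rfl).symm
  -- Factor `a² - b² = (a - b)(a + b)` and apply the weighted AM-GM inequality; the weight `l` makes
  -- both sums contribute `2 l ‖u‖²`.
  calc ∑ g ∈ v.support, (v g - min (v g) (v (s * g)))
      ≤ ∑ g ∈ u.support, (1 / (2 * l) * (u (s * g) - u g) ^ 2 +
          l * (u g ^ 2 + u (s * g) ^ 2)) := by
        rw [hsupp]
        refine Finset.sum_le_sum fun g _ => ?_
        rw [hva, hva]
        rcases le_total (u g ^ 2) (u (s * g) ^ 2) with h | h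
        · rw [min_eq_left h, sub_self]; positivity
        · rw [min_eq_right h]
          have e : 1 / (2 * l) * (u (s * g) - u g) ^ 2 + l * (u g ^ 2 + u (s * g) ^ 2) -
              (u g ^ 2 - u (s * g) ^ 2) =
              1 / (2 * l) * ((u g - u (s * g)) - l * (u g + u (s * g))) ^ 2 +
                l / 2 * (u g - u (s * g)) ^ 2 := by
            field_simp
            ring
          rw [← sub_nonneg, e]
          positivity
    _ = 1 / (2 * l) * ∑ g ∈ u.support, (u (s * g) - u g) ^ 2 +
          l * (∑ g ∈ u.support, u g ^ 2 + ∑ g ∈ u.support, u (s * g) ^ 2) := by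
        rw [Finset.sum_add_distrib, ← Finset.mul_sum, ← Finset.mul_sum, Finset.sum_add_distrib]
    _ ≤ 1 / (2 * l) * (4 * l ^ 2 * dotForm G u u) + l * (dotForm G u u + dotForm G u u) := by
        rw [h3]; gcongr
    _ ≤ _ := by
        apply le_of_eq
        field_simp
        ring

/-- A lower bound on the return probability at time `2N` yields a Følner set. -/
theorem IsSymmWeight.exists_foelner_set (hw : IsSymmWeight w) (S : Finset G) {q δ l : ℝ}
    (hq : 0 < q) (h1 : q ≤ w 1) (hS : ∀ s ∈ S, q ≤ w s) (hδ : δ ≤ 1) (hl : 0 < l)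
    (hδl : 8 * δ / q ≤ 4 * l ^ 2) {N : ℕ} (hN : N ≠ 0)
    (hret : (1 - δ) ^ N ≤ dotForm G (walkLaw w N) (walkLaw w N)) :
    ∃ F : Finset G, F.Nonempty ∧
      (F.card : ℝ) * dotForm G (walkLaw w N) (walkLaw w N) ≤ 4 ∧
      ((innerBoundary S F).card : ℝ) ≤ S.card * (4 * l) * F.card := by
  classical
  set a : ℕ → ℝ := fun k => dotForm G (walkLaw w k) (walkLaw w k) with ha
  have ha0 : a 0 = 1 := by
    simp only [ha, walkLaw_zero]
    rw [dotForm_single_right]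
    simp
  have hanti : Antitone a := antitone_nat_of_succ_le fun k => by
    simp only [ha, walkLaw_succ]
    exact hw.dotForm_walkOp_self_le _
  obtain ⟨i, hi, hai⟩ := exists_lt_mul_le_of_pow_le a ha0 (sub_nonneg.2 hδ) hN hret
  set f := walkLaw w i with hf
  have hf0 : ∀ g, 0 ≤ f g := hw.walkLaw_nonneg i
  have hsum : ∑ g ∈ f.support, f g = 1 := hw.sum_walkLaw i
  have hapos : 0 < dotForm G f f := hw.dotForm_walkLaw_pos i
  -- As `f` has mass `1`, truncating at `η` costs at most `2η = ‖f‖² / 2` of the squared norm, and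
  -- at most `1 / η` points survive.
  set η := dotForm G f f / 4 with hη
  have hηpos : 0 < η := by positivity
  set u : G →₀ ℝ := f.mapRange (fun t => max (t - η) 0) (by simp [hηpos.le]) with hu
  have hua (g : G) : u g = max (f g - η) 0 := by rw [hu, Finsupp.mapRange_apply]
  have husupp : u.support ⊆ f.support := Finsupp.support_mapRange
  have hunorm : dotForm G f f ≤ 2 * dotForm G u u := by
    have h2 : dotForm G f f - 2 * η ≤ dotForm G u u := by
      rw [dotForm_self_eq_sum u husupp, dotForm_self_eq_sum f subset_rfl]
      calc _ = ∑ g ∈ f.support, (f g ^ 2 - 2 * η * f g) := by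
            rw [Finset.sum_sub_distrib, ← Finset.mul_sum, hsum, mul_one]
        _ ≤ _ := by
            refine Finset.sum_le_sum fun g _ => ?_
            rw [hua]
            have := hf0 g
            rcases le_total (f g) η with h | h
            · rw [max_eq_right (by linarith)]; nlinarith
            · rw [max_eq_left (by linarith)]; nlinarith
    linarith
  have hu0 : u ≠ 0 := by
    intro h
    rw [h] at hunorm
    simp only [map_zero, mul_zero] at hunorm
    linarith
  have hinv : ∀ s ∈ S, dotForm G (u.mapDomain (s⁻¹ * ·) - u) (u.mapDomain (s⁻¹ * ·) - u) ≤
      4 * l ^ 2 * dotForm G u u := by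
    intro s hs
    have h2 : dotForm G (f.mapDomain (s⁻¹ * ·) - f) (f.mapDomain (s⁻¹ * ·) - f) ≤
        4 * δ / q * dotForm G f f :=
      hw.dotForm_mapDomain_sub_self_le (φ := MulAction.toPermHom G G) hq h1 (s := s⁻¹)
        (by rw [hw.inv]; exact hS s hs) (by simpa only [ha, walkLaw_succ] using hai)
    have h3 : dotForm G (u.mapDomain (s⁻¹ * ·) - u) (u.mapDomain (s⁻¹ * ·) - u) ≤
        dotForm G (f.mapDomain (s⁻¹ * ·) - f) (f.mapDomain (s⁻¹ * ·) - f) := by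
      refine dotForm_self_mono fun g => ?_
      have htr (k : G →₀ ℝ) : k.mapDomain (s⁻¹ * ·) g = k (s * g) := by
        have h := Finsupp.mapDomain_apply (mul_right_injective s⁻¹) k (s * g)
        simpa using h
      rw [Finsupp.sub_apply, Finsupp.sub_apply, htr, htr, hua, hua]
      refine (abs_max_sub_max_le_abs _ _ _).trans (le_of_eq ?_)
      congr 1
      ring
    refine h3.trans (h2.trans ?_)
    rcases le_total 0 δ with h | h
    · calc 4 * δ / q * dotForm G f f ≤ 4 * δ / q * (2 * dotForm G u u) := by gcongr
        _ = 8 * δ / q * dotForm G u u := by ring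
        _ ≤ _ := mul_le_mul_of_nonneg_right hδl (dotForm_self_nonneg u)
    · have h4 : 4 * δ / q * dotForm G f f ≤ 0 :=
        mul_nonpos_of_nonpos_of_nonneg (div_nonpos_of_nonpos_of_nonneg (by linarith) hq.le) hapos.le
      have h5 := dotForm_self_nonneg u
      exact h4.trans (by positivity)
  obtain ⟨F, hFne, hFu, hFb⟩ := exists_innerBoundary_card_le_of_almost_invariant S u
    hu0 hl hinv
  refine ⟨F, hFne, ?_, hFb⟩
  have hFη : (F.card : ℝ) * η ≤ 1 := by
    rw [← hsum, ← nsmul_eq_mul]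
    refine (Finset.card_nsmul_le_sum F f η fun g hg => ?_).trans
      (Finset.sum_le_sum_of_subset_of_nonneg (hFu.trans husupp) fun g _ _ => hf0 g)
    have h2 := Finsupp.mem_support_iff.1 (hFu hg)
    rw [hua] at h2
    by_contra hlt
    exact h2 (max_eq_right (by linarith))
  calc (F.card : ℝ) * dotForm G (walkLaw w N) (walkLaw w N) ≤ F.card * dotForm G f f :=
        mul_le_mul_of_nonneg_left (hanti hi.le) (Nat.cast_nonneg _)
    _ = 4 * (F.card * η) := by rw [hη]; ring
    _ ≤ 4 := by linarith

end Foelner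

/-! ### Displacements and windows in the topological full group -/

namespace SymbolicDynamics.FullShift.Subshift

variable {A : Type*} [TopologicalSpace A] (Y : Subshift A ℤ)

lemma shiftHomeo_zpow_apply (k : ℤ) (x : Y.carrier) (i : ℤ) :
    ((Y.shiftHomeo ^ k) x).1 i = x.1 (i + k) := by
  induction k using Int.induction_on generalizing x with
  | zero => simp
  | succ k ih =>
    rw [zpow_add_one, Homeomorph.mul_apply, ih]
    exact congrArg x.1 (by ring)
  | pred k ih =>
    rw [zpow_sub_one, Homeomorph.mul_apply, ih]
    exact congrArg x.1 (by ring)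

/-- A fixed point is a `k`-periodic sequence, determined by `|k|` consecutive letters. -/
lemma finite_setOf_zpow_fixed [Finite A] {k : ℤ} (hk : k ≠ 0) :
    {x : Y.carrier | (Y.shiftHomeo ^ k) x = x}.Finite := by
  refine Set.Finite.of_injOn (f := fun x (j : Fin k.natAbs) => x.1 (j : ℕ)) (t := Set.univ)
    (fun _ _ => trivial) ?_ Set.finite_univ
  intro x hx y hy hxy
  have hper (z : Y.carrier) (hz : (Y.shiftHomeo ^ k) z = z) (i : ℤ) : z.1 i = z.1 (i % k) := by
    have h1 : Function.Periodic z.1 k := fun i => by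
      rw [← Y.shiftHomeo_zpow_apply, hz]
    have h2 := (h1.int_mul (i / k)) (i % k)
    rw [← h2]
    refine congrArg z.1 ?_
    rw [Int.cast_id, mul_comm, Int.emod_add_mul_ediv]
  ext i
  rw [hper x hx, hper y hy]
  have h1 : 0 ≤ i % k := Int.emod_nonneg i hk
  have h2 : i % k < |k| := Int.emod_lt_abs i hk
  rw [Int.abs_eq_natAbs] at h2
  have h3 := congrFun hxy ⟨(i % k).toNat, by omega⟩
  simpa [Int.toNat_of_nonneg h1] using h3

/-- Two powers of the shift that coincide near a point are equal. -/
lemma NoIsolatedPeriodicPoints.zpow_eq [Finite A] [T1Space A] {Y : Subshift A ℤ}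
    (hper : Y.NoIsolatedPeriodicPoints) {x : Y.carrier} {k l : ℤ}
    (h : ∀ᶠ y in 𝓝 x, (Y.shiftHomeo ^ k) y = (Y.shiftHomeo ^ l) y) : k = l := by
  by_contra hne
  have hfix (y : Y.carrier) (hy : (Y.shiftHomeo ^ k) y = (Y.shiftHomeo ^ l) y) :
      (Y.shiftHomeo ^ (k - l)) y = y := by
    rw [sub_eq_neg_add, zpow_add, Homeomorph.mul_apply, hy, ← Homeomorph.mul_apply, ← zpow_add]
    simp
  have hfin := Y.finite_setOf_zpow_fixed (sub_ne_zero.2 hne)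
  set P := {x : Y.carrier | (Y.shiftHomeo ^ (k - l)) x = x} with hP
  -- A neighbourhood of `x` lies in the finite set `P`, so `x` is periodic and isolated.
  have hmem : P ∈ 𝓝 x := h.mono hfix
  have hx : (Y.shiftHomeo ^ (k - l)) x = x := h.mono hfix |>.self_of_nhds
  refine hper x ?_ ?_
  · refine ⟨(k - l).natAbs, Int.natAbs_pos.2 (sub_ne_zero.2 hne), ?_⟩
    have h1 : (Y.shiftHomeo ^ ((k - l).natAbs : ℤ)) x = x := by
      rcases Int.natAbs_eq (k - l) with h | h
      · rw [← h]; exact hx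
      · have h2 : (((k - l).natAbs : ℕ) : ℤ) = -(k - l) := by omega
        rw [h2]
        conv_lhs => rw [← hx]
        rw [← Homeomorph.mul_apply, ← zpow_add]
        simp
    have h3 (n : ℕ) (z : Y.carrier) : Y.shiftHomeo^[n] z = (Y.shiftHomeo ^ (n : ℤ)) z := by
      induction n generalizing z with
      | zero => simp
      | succ n ih =>
        rw [Function.iterate_succ_apply, ih, Nat.cast_succ, zpow_add_one, Homeomorph.mul_apply]
    rw [Function.IsPeriodicPt, Function.IsFixedPt, h3, h1]
  · have h2 : (P \ {x})ᶜ ∈ 𝓝 x :=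
      (hfin.subset Set.sdiff_subset).isClosed.isOpen_compl.mem_nhds fun h => h.2 rfl
    have h3 : {x} ∈ 𝓝 x := by
      filter_upwards [hmem, h2] with y hy hy'
      by_contra hyx
      exact hy' ⟨hy, hyx⟩
    exact isOpen_singleton_iff_nhds_eq_pure x |>.2
      (le_antisymm (by rwa [le_pure_iff]) (pure_le_nhds x))

/-- The displacement of an element of the topological full group at a point: the power of the
shift with which it coincides nearby. -/
noncomputable def disp {Y : Subshift A ℤ} (g : topologicalFullGroup Y.shiftHomeo)
    (x : Y.carrier) : ℤ :=
  (g.2 x).choose_spec.2.2.choose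

lemma eventually_eq_disp {Y : Subshift A ℤ} (g : topologicalFullGroup Y.shiftHomeo)
    (x : Y.carrier) : ∀ᶠ y in 𝓝 x, g.1 y = (Y.shiftHomeo ^ disp g x) y :=
  Filter.mem_of_superset ((g.2 x).choose_spec.1.mem_nhds (g.2 x).choose_spec.2.1)
    (g.2 x).choose_spec.2.2.choose_spec

lemma apply_eq_disp {Y : Subshift A ℤ} (g : topologicalFullGroup Y.shiftHomeo)
    (x : Y.carrier) : g.1 x = (Y.shiftHomeo ^ disp g x) x :=
  (eventually_eq_disp g x).self_of_nhds

namespace NoIsolatedPeriodicPoints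

variable [Finite A] [T1Space A] {Y : Subshift A ℤ} (hper : Y.NoIsolatedPeriodicPoints)
include hper

/-- Uniqueness of the local power makes the chosen `disp` canonical; the cocycle rule and local
constancy follow. -/
lemma disp_eq {g : topologicalFullGroup Y.shiftHomeo} {x : Y.carrier} {k : ℤ}
    (h : ∀ᶠ y in 𝓝 x, g.1 y = (Y.shiftHomeo ^ k) y) : disp g x = k :=
  hper.zpow_eq (x := x) (by filter_upwards [h, eventually_eq_disp g x] with y h1 h2; rw [← h1, h2])

lemma disp_one (x : Y.carrier) : disp (1 : topologicalFullGroup Y.shiftHomeo) x = 0 :=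
  hper.disp_eq (by simp)

lemma disp_mul (g h : topologicalFullGroup Y.shiftHomeo) (x : Y.carrier) :
    disp (g * h) x = disp g (h.1 x) + disp h x := by
  refine hper.disp_eq ?_
  have h1 := h.1.continuous.continuousAt.eventually (eventually_eq_disp g (h.1 x))
  filter_upwards [h1, eventually_eq_disp h x] with y hy1 hy2
  rw [zpow_add, Homeomorph.mul_apply, ← hy2, ← hy1]
  rfl

lemma eventually_disp_eq (g : topologicalFullGroup Y.shiftHomeo) (x : Y.carrier) :
    ∀ᶠ y in 𝓝 x, disp g y = disp g x :=
  (eventually_eq_disp g x).eventually_nhds.mono fun _ hy => hper.disp_eq hy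

/-- The action of the topological full group on the orbit of `x`, parametrized by `ℤ`. -/
noncomputable def orbitAction (x : Y.carrier) :
    topologicalFullGroup Y.shiftHomeo →* Equiv.Perm ℤ :=
  MonoidHom.toHomPerm
    { toFun g i := i + disp g ((Y.shiftHomeo ^ i) x)
      map_one' := by funext i; simp [hper.disp_one]; rfl
      map_mul' g h := by
        funext i
        change _ = i + disp h ((Y.shiftHomeo ^ i) x) +
          disp g ((Y.shiftHomeo ^ (i + disp h ((Y.shiftHomeo ^ i) x))) x)
        rw [hper.disp_mul, apply_eq_disp h, ← Homeomorph.mul_apply, ← zpow_add,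
          add_comm (disp h _) i]
        ring }

lemma orbitAction_apply (x : Y.carrier) (g : topologicalFullGroup Y.shiftHomeo) (i : ℤ) :
    hper.orbitAction x g i = i + disp g ((Y.shiftHomeo ^ i) x) := rfl

end NoIsolatedPeriodicPoints

section Windows

variable {Y : Subshift A ℤ}

/-- The word read by `x` on `[-R, R]`. -/
def centralWord (R : ℕ) (x : Y.carrier) (j : Fin (2 * R + 1)) : A := x.1 (-R + (j : ℕ))

lemma centralWord_eq_iff {R : ℕ} {x y : Y.carrier} :
    centralWord R x = centralWord R y ↔ ∀ i : ℤ, |i| ≤ R → x.1 i = y.1 i := by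
  constructor
  · intro h i hi
    rw [abs_le] at hi
    have h1 := congrFun h ⟨(i + R).toNat, by omega⟩
    simp only [centralWord] at h1
    rwa [Int.toNat_of_nonneg (by omega), show -(R : ℤ) + (i + R) = i by ring] at h1
  · intro h
    funext j
    refine h _ ?_
    have := j.2
    rw [abs_le]
    omega

lemma complexity_two_mul_add_one (R : ℕ) :
    Y.complexity (2 * R + 1) = (Set.range (centralWord (Y := Y) R)).ncard := by
  rw [complexity]
  congr 1
  ext w
  constructor
  · rintro ⟨x, hx, i, hi⟩
    refine ⟨(Y.shiftHomeo ^ (i + R)) ⟨x, hx⟩, funext fun j => ?_⟩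
    rw [centralWord, shiftHomeo_zpow_apply, ← hi]
    exact congrArg x (by ring)
  · rintro ⟨x, rfl⟩
    exact ⟨x.1, x.2, -R, fun j => rfl⟩

lemma complexity_mono [Finite A] : Monotone Y.complexity := by
  refine monotone_nat_of_le_succ fun n => ?_
  rw [complexity, complexity]
  refine (Set.ncard_le_ncard (t := (fun (w : Fin (n + 1) → A) (j : Fin n) => w j.castSucc) ''
    {w : Fin (n + 1) → A | ∃ x ∈ Y.carrier, ∃ i : ℤ, ∀ j : Fin (n + 1), x (i + (j : ℕ)) = w j})
    ?_ (Set.toFinite _)).trans (Set.ncard_image_le (Set.toFinite _))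
  rintro w ⟨x, hx, i, hi⟩
  exact ⟨fun j => x (i + (j : ℕ)), ⟨x, hx, i, fun j => rfl⟩, funext fun j => hi j⟩

/-- `g` has window `R` if its displacement at `x` depends only on `x` on `[-R, R]`. -/
def HasWindow (g : topologicalFullGroup Y.shiftHomeo) (R : ℕ) : Prop :=
  ∀ x y, centralWord R x = centralWord R y → disp g x = disp g y

lemma HasWindow.mono {g : topologicalFullGroup Y.shiftHomeo} {R R' : ℕ} (h : HasWindow g R)
    (hR : R ≤ R') : HasWindow g R' := fun x y hxy => h x y <| by
  rw [centralWord_eq_iff] at hxy ⊢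
  exact fun i hi => hxy i (hi.trans (by exact_mod_cast hR))

lemma isOpen_setOf_centralWord_eq [DiscreteTopology A] (R : ℕ) (x : Y.carrier) :
    IsOpen {y : Y.carrier | centralWord R y = centralWord R x} := by
  have : Continuous (centralWord (Y := Y) R) :=
    continuous_pi fun j => (continuous_apply _).comp continuous_subtype_val
  exact (isOpen_discrete {centralWord R x}).preimage this

lemma exists_centralWord_subset_of_mem_nhds {x : Y.carrier} {U : Set Y.carrier} (hU : U ∈ 𝓝 x) :
    ∃ R : ℕ, ∀ y : Y.carrier, centralWord R y = centralWord R x → y ∈ U := by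
  rw [nhds_subtype, Filter.mem_comap] at hU
  obtain ⟨V, hV, hVU⟩ := hU
  rw [nhds_pi, Filter.mem_pi] at hV
  obtain ⟨I, hI, t, ht, htV⟩ := hV
  obtain ⟨R, hR⟩ := (hI.image Int.natAbs).bddAbove
  refine ⟨R, fun y hy => hVU (htV fun i hi => ?_)⟩
  rw [centralWord_eq_iff.1 hy i ?_]
  · exact mem_of_mem_nhds (ht i)
  · have := hR (Set.mem_image_of_mem _ hi)
    rw [Int.abs_eq_natAbs]
    exact_mod_cast this

namespace NoIsolatedPeriodicPoints

variable [Finite A] [DiscreteTopology A] (hper : Y.NoIsolatedPeriodicPoints)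
include hper

/-- The displacement is locally constant and the subshift is compact, so finitely many cylinders
suffice. -/
lemma exists_hasWindow (g : topologicalFullGroup Y.shiftHomeo) : ∃ R, HasWindow g R := by
  have : CompactSpace Y.carrier := isCompact_iff_compactSpace.1 Y.isClosed.isCompact
  choose R hR using fun x => exists_centralWord_subset_of_mem_nhds (hper.eventually_disp_eq g x)
  obtain ⟨t, ht⟩ := isCompact_univ.elim_finite_subcover
    (fun x : Y.carrier => {y : Y.carrier | centralWord (R x) y = centralWord (R x) x})
    (fun x => isOpen_setOf_centralWord_eq _ _) fun x _ => Set.mem_iUnion.2 ⟨x, rfl⟩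
  refine ⟨t.sup R, fun x y hxy => ?_⟩
  obtain ⟨z, hz, hxz⟩ := Set.mem_iUnion₂.1 (ht (Set.mem_univ x))
  have hyx : centralWord (R z) y = centralWord (R z) x := by
    rw [centralWord_eq_iff] at hxy ⊢
    exact fun i hi => (hxy i (hi.trans (by exact_mod_cast Finset.le_sup hz))).symm
  rw [hR z x hxz, hR z y (hyx.trans hxz)]

lemma exists_abs_disp_le (g : topologicalFullGroup Y.shiftHomeo) :
    ∃ D : ℕ, ∀ x, |disp g x| ≤ D := by
  have : CompactSpace Y.carrier := isCompact_iff_compactSpace.1 Y.isClosed.isCompact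
  have hc : Continuous fun x => disp g x := by
    rw [continuous_iff_continuousAt]
    intro x
    rw [ContinuousAt, nhds_discrete ℤ, tendsto_pure]
    exact hper.eventually_disp_eq g x
  obtain ⟨D, hD⟩ := ((isCompact_range hc).finite_of_discrete.image Int.natAbs).bddAbove
  refine ⟨D, fun x => ?_⟩
  have := hD (Set.mem_image_of_mem _ (Set.mem_range_self x))
  rw [Int.abs_eq_natAbs]
  exact_mod_cast this

lemma exists_window_and_abs_disp_le (S : Finset (topologicalFullGroup Y.shiftHomeo)) :
    ∃ D : ℕ, 0 < D ∧ ∀ s ∈ S, HasWindow s D ∧ ∀ x, |disp s x| ≤ D := by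
  choose R hR using hper.exists_hasWindow
  choose D hD using hper.exists_abs_disp_le
  refine ⟨S.sup R + S.sup D + 1, by omega, fun s hs => ⟨(hR s).mono ?_, fun x => (hD s x).trans ?_⟩⟩
  · have := Finset.le_sup (f := R) hs
    omega
  · have := Finset.le_sup (f := D) hs
    exact_mod_cast (by omega)

lemma hasWindow_one (R : ℕ) : HasWindow (1 : topologicalFullGroup Y.shiftHomeo) R :=
  fun x y _ => by rw [hper.disp_one, hper.disp_one]

/-- In `disp g (h x) + disp h x`, the first term reads `h x` on `[-D, D]`, that is, `x` on this
interval moved by at most `r`. Hence for `R = r + D` the window does not grow under multiplication.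
-/
lemma hasWindow_mul {g h : topologicalFullGroup Y.shiftHomeo} {r D R : ℕ} (hg : HasWindow g D)
    (hh : HasWindow h R) (hr : ∀ x, |disp h x| ≤ r) (hR : r + D ≤ R) : HasWindow (g * h) R := by
  intro x y hxy
  rw [hper.disp_mul, hper.disp_mul, hh x y hxy, add_left_inj]
  refine hg _ _ ?_
  rw [centralWord_eq_iff] at hxy ⊢
  intro i hi
  rw [apply_eq_disp h x, apply_eq_disp h y, shiftHomeo_zpow_apply, shiftHomeo_zpow_apply,
    hh x y (centralWord_eq_iff.2 hxy)]
  refine hxy _ ?_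
  have := hr y
  have := abs_add_le i (disp h y)
  omega

end NoIsolatedPeriodicPoints

/-- An element of the topological full group is determined by its displacement. -/
lemma ext_disp {g h : topologicalFullGroup Y.shiftHomeo} (hgh : ∀ x, disp g x = disp h x) :
    g = h := by
  refine Subtype.ext (Homeomorph.ext fun x => ?_)
  rw [apply_eq_disp g, apply_eq_disp h, hgh]

/-- The elements with displacement at most `r` and with window `R`. -/
def localElements (Y : Subshift A ℤ) (r R : ℕ) : Set (topologicalFullGroup Y.shiftHomeo) :=
  {g | (∀ x, |disp g x| ≤ r) ∧ HasWindow g R}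

/-- Such an element is encoded by a function from the central words of radius `R` to `[-r, r]`. -/
lemma finite_localElements_and_ncard_le [Finite A] (r R : ℕ) :
    (localElements Y r R).Finite ∧
      (localElements Y r R).ncard ≤ (2 * r + 1) ^ Y.complexity (2 * R + 1) := by
  classical
  have : Fintype (Set.range (centralWord (Y := Y) R)) := Fintype.ofFinite _
  choose x hx using fun w : Set.range (centralWord (Y := Y) R) => w.2
  let f (g : topologicalFullGroup Y.shiftHomeo) (w : Set.range (centralWord (Y := Y) R)) : ℤ :=
    disp g (x w)
  let t : Finset (Set.range (centralWord (Y := Y) R) → ℤ) :=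
    Fintype.piFinset fun _ => Finset.Icc (-(r : ℤ)) r
  have hmaps : Set.MapsTo f (localElements Y r R) (t : Set _) := fun g hg => by
    rw [Finset.mem_coe, Fintype.mem_piFinset]
    exact fun w => Finset.mem_Icc.2 (abs_le.1 (hg.1 _))
  have hinj : Set.InjOn f (localElements Y r R) := fun g hg h hh hgh => ext_disp fun y => by
    have e : centralWord R y = centralWord R (x ⟨_, Set.mem_range_self y⟩) :=
      (hx ⟨_, Set.mem_range_self y⟩).symm
    rw [hg.2 _ _ e, hh.2 _ _ e]
    exact congrFun hgh _
  refine ⟨Set.Finite.of_injOn hmaps hinj t.finite_toSet, ?_⟩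
  refine (Set.ncard_le_ncard_of_injOn f hmaps hinj t.finite_toSet).trans (le_of_eq ?_)
  rw [Set.ncard_coe_finset, Fintype.card_piFinset, Finset.prod_const, Int.card_Icc,
    complexity_two_mul_add_one, Finset.card_univ, ← Nat.card_eq_fintype_card, Set.ncard]
  congr 1
  omega

end Windows

end SymbolicDynamics.FullShift.Subshift

/-! ### The lower bound on return probabilities -/

namespace SymbolicDynamics.FullShift.Subshift

variable {A : Type*} [TopologicalSpace A] [Finite A] [DiscreteTopology A] {Y : Subshift A ℤ}
  {w : topologicalFullGroup Y.shiftHomeo →₀ ℝ} {D : ℕ}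

namespace NoIsolatedPeriodicPoints

variable (hper : Y.NoIsolatedPeriodicPoints)
include hper

/-- This crude linear window reduces the union bound over all points to one over words of length
`2nD + 1`. -/
lemma hasWindow_of_mem_support_walkLaw
    (hD : ∀ s ∈ w.support, HasWindow s D ∧ ∀ x, |disp s x| ≤ D) (n : ℕ)
    {g : topologicalFullGroup Y.shiftHomeo} (hg : g ∈ (walkLaw w n).support) :
    HasWindow g (n * D) := by
  refine (walkLaw_support_induction (fun n g => HasWindow g (n * D) ∧ ∀ x, |disp g x| ≤ (n * D : ℕ))
    ⟨hper.hasWindow_one _, fun x => by simp [hper.disp_one]⟩ ?_ n hg).1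
  rintro n s hs g ⟨h1, h2⟩
  have hle : n * D + D ≤ (n + 1) * D := by rw [add_mul, one_mul]
  refine ⟨hper.hasWindow_mul (hD s hs).1 (h1.mono (by omega)) h2 hle, fun x => ?_⟩
  rw [hper.disp_mul]
  refine (abs_add_le _ _).trans ((add_le_add ((hD s hs).2 _) (h2 x)).trans ?_)
  exact_mod_cast (by omega)

/-- The probability that some point is displaced by more than `r`. -/
lemma massOf_exists_lt_abs_disp_le (hw : IsSymmWeight w) (hD₀ : 0 < D)
    (hD : ∀ s ∈ w.support, HasWindow s D ∧ ∀ x, |disp s x| ≤ D) {n : ℕ} (hn : n ≠ 0) (r : ℕ) :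
    massOf {g | ∃ x, (r : ℤ) < |disp g x|} (walkLaw w n) ≤
      Y.complexity (2 * (n * D) + 1) *
        ((2 * (n * D) + 1) * (2 * Real.exp (-((r : ℝ) ^ 2 / (2 * (D : ℝ) ^ 2 * n))))) := by
  classical
  have : Fintype (Set.range (centralWord (Y := Y) (n * D))) := Fintype.ofFinite _
  choose x hx using fun v : Set.range (centralWord (Y := Y) (n * D)) => v.2
  have h0 := hw.walkLaw_nonneg n
  calc _ ≤ massOf {g | ∃ v ∈ Finset.univ, g ∈ {g | (r : ℤ) < |hper.orbitAction (x v) g 0|}}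
          (walkLaw w n) := by
        refine massOf_mono h0 fun g hg => ?_
        rintro ⟨y, hy⟩
        refine ⟨⟨_, Set.mem_range_self y⟩, Finset.mem_univ _, ?_⟩
        have e := hper.hasWindow_of_mem_support_walkLaw hD n hg y
          (x ⟨_, Set.mem_range_self y⟩) (hx ⟨_, Set.mem_range_self y⟩).symm
        rw [e] at hy
        change (r : ℤ) < |hper.orbitAction (x ⟨_, Set.mem_range_self y⟩) g 0|
        rw [hper.orbitAction_apply, zero_add, zpow_zero]
        exact hy
    _ ≤ ∑ v, massOf {g | (r : ℤ) < |hper.orbitAction (x v) g 0|} (walkLaw w n) :=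
        massOf_iUnion_le h0 Finset.univ fun v => {g | (r : ℤ) < |hper.orbitAction (x v) g 0|}
    _ ≤ ∑ v : Set.range (centralWord (Y := Y) (n * D)),
          ((2 * (n * D) + 1) * (2 * Real.exp (-((r : ℝ) ^ 2 / (2 * (D : ℝ) ^ 2 * n))))) := by
        refine Finset.sum_le_sum fun v _ =>
          hw.massOf_walkLaw_displacement_le _ hD₀ (fun s hs i => ?_) hn r
        rw [hper.orbitAction_apply, add_sub_cancel_left]
        exact (hD s hs).2 _
    _ = _ := by
        rw [Finset.sum_const, nsmul_eq_mul, complexity_two_mul_add_one, Finset.card_univ,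
          ← Nat.card_eq_fintype_card, Nat.card_coe_set_eq]

/-- By `hasWindow_mul`, a step from a local element can leave the set only by producing a
displacement above `r`. -/
lemma massOf_localElements_compl_succ_le (hw : IsSymmWeight w)
    (hD : ∀ s ∈ w.support, HasWindow s D ∧ ∀ x, |disp s x| ≤ D) (n r : ℕ) :
    massOf (localElements Y r (r + D))ᶜ (walkLaw w (n + 1)) ≤
      massOf (localElements Y r (r + D))ᶜ (walkLaw w n) +
        massOf {g | ∃ x, (r : ℤ) < |disp g x|} (walkLaw w (n + 1)) := by
  have h0 := hw.walkLaw_nonneg n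
  rw [massOf_walkLaw_succ, massOf_walkLaw_succ]
  calc _ ≤ ∑ s ∈ w.support, w s * (massOf (localElements Y r (r + D))ᶜ (walkLaw w n) +
          massOf {g | s * g ∈ {g | ∃ x, (r : ℤ) < |disp g x|}} (walkLaw w n)) := by
        refine Finset.sum_le_sum fun s hs => mul_le_mul_of_nonneg_left ?_ (hw.nonneg s)
        refine (massOf_mono h0 fun g _ hg => ?_).trans (massOf_union_le h0 _ _)
        by_contra hcon
        rw [Set.mem_union, not_or, Set.mem_compl_iff, not_not] at hcon
        have h1 : ∀ x, |disp (s * g) x| ≤ r := by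
          by_contra! h
          exact hcon.2 h
        exact hg ⟨h1, hper.hasWindow_mul (hD s hs).1 hcon.1.2 hcon.1.1 le_rfl⟩
    _ = _ := by
        simp only [mul_add, Finset.sum_add_distrib, ← Finset.sum_mul, hw.sum_eq_one, one_mul]

lemma massOf_localElements_compl_le (hw : IsSymmWeight w) (hD₀ : 0 < D)
    (hD : ∀ s ∈ w.support, HasWindow s D ∧ ∀ x, |disp s x| ≤ D) {n m : ℕ} (hm : m ≤ n) (r : ℕ) :
    massOf (localElements Y r (r + D))ᶜ (walkLaw w m) ≤
      m * (Y.complexity (2 * (n * D) + 1) *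
        ((2 * (n * D) + 1) * (2 * Real.exp (-((r : ℝ) ^ 2 / (2 * (D : ℝ) ^ 2 * n)))))) := by
  induction m with
  | zero =>
    rw [massOf_apply]
    refine le_of_eq_of_le (Finset.sum_eq_zero fun g hg => ?_) (by simp)
    rw [walkLaw_zero] at hg
    rw [Finset.mem_singleton.1 (Finsupp.support_single_subset hg), Set.indicator_of_notMem, mul_zero]
    exact not_not.2 ⟨fun x => by simp [hper.disp_one], hper.hasWindow_one _⟩
  | succ m ih =>
    refine (hper.massOf_localElements_compl_succ_le hw hD m r).trans ?_
    have h1 := hper.massOf_exists_lt_abs_disp_le hw hD₀ hD (Nat.succ_ne_zero m) r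
    have h2 : (Y.complexity (2 * ((m + 1) * D) + 1) : ℝ) ≤ Y.complexity (2 * (n * D) + 1) := by
      exact_mod_cast complexity_mono (by gcongr)
    have h3 : ((m + 1 : ℕ) : ℝ) ≤ n := by exact_mod_cast hm
    refine (add_le_add (ih (by omega)) (h1.trans (b := _) (c := Y.complexity (2 * (n * D) + 1) *
        ((2 * (n * D) + 1) * (2 * Real.exp (-((r : ℝ) ^ 2 / (2 * (D : ℝ) ^ 2 * n)))))) ?_)).trans
      (le_of_eq (by push_cast; ring))
    have h4 : (0 : ℝ) < (m + 1 : ℕ) := by positivity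
    have h5 : (0 : ℝ) < D := by exact_mod_cast hD₀
    gcongr

/-- A lower bound on the return probability, provided that large displacements are unlikely. -/
lemma one_le_mul_dotForm_walkLaw (hw : IsSymmWeight w) (hD₀ : 0 < D)
    (hD : ∀ s ∈ w.support, HasWindow s D ∧ ∀ x, |disp s x| ≤ D) {n r : ℕ}
    (h : n * (Y.complexity (2 * (n * D) + 1) * ((2 * (n * D) + 1) *
      (2 * Real.exp (-((r : ℝ) ^ 2 / (2 * (D : ℝ) ^ 2 * n)))))) ≤ 1 / 2) :
    1 ≤ 4 * (2 * (r : ℝ) + 1) ^ Y.complexity (2 * (r + D) + 1) *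
      dotForm _ (walkLaw w n) (walkLaw w n) := by
  have h1 := hper.massOf_localElements_compl_le hw hD₀ hD (le_refl n) r
  have h2 := massOf_add_massOf_compl (localElements Y r (r + D)) (walkLaw w n)
  rw [hw.sum_walkLaw] at h2
  obtain ⟨hfin, hcard⟩ := finite_localElements_and_ncard_le (Y := Y) r (r + D)
  refine (one_le_four_mul_card_mul_dotForm (f := walkLaw w n) hfin (by linarith)).trans ?_
  have h3 := dotForm_self_nonneg (walkLaw w n)
  have h4 : ((localElements Y r (r + D)).ncard : ℝ) ≤
      (2 * (r : ℝ) + 1) ^ Y.complexity (2 * (r + D) + 1) := by exact_mod_cast hcard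
  gcongr

/-- The lower bound on return probabilities for large times. -/
lemma eventually_le_dotForm_walkLaw (hw : IsSymmWeight w) (hD₀ : 0 < D)
    (hD : ∀ s ∈ w.support, HasWindow s D ∧ ∀ x, |disp s x| ≤ D)
    (hrho : Tendsto (fun n : ℕ => (Real.log (n : ℝ) / (n : ℝ)) ^ 2 * (Y.complexity n : ℝ))
      atTop (𝓝 0)) :
    ∀ᶠ n : ℕ in atTop,
      1 / 4 * Real.exp (-2 * (Y.complexity ⌈(13 * D : ℝ) * √((n : ℝ) * Real.log (n : ℝ))⌉₊ : ℝ)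
          * Real.log (n : ℝ)) ≤ dotForm _ (walkLaw w n) (walkLaw w n) := by
  have hrho' : ∀ᶠ m : ℕ in atTop, (Y.complexity m : ℝ) ≤ (m : ℝ) ^ 2 := by
    filter_upwards [hrho.eventually_le_const zero_lt_one, eventually_ge_atTop 3] with m hm h3
    have h3' : (3 : ℝ) ≤ m := by exact_mod_cast h3
    have hlog : 1 ≤ Real.log m := by
      rw [Real.le_log_iff_exp_le (by linarith)]
      exact (Real.exp_one_lt_d9.trans (by norm_num)).le.trans h3'
    rw [div_pow, div_mul_eq_mul_div, div_le_one (by positivity)] at hm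
    refine le_trans ?_ hm
    exact le_mul_of_one_le_left (Nat.cast_nonneg _) (one_le_pow₀ hlog)
  have htend : Tendsto (fun n : ℕ => 2 * (n * D) + 1) atTop atTop :=
    tendsto_atTop_mono (fun n => show n ≤ _ by
      have := Nat.le_mul_of_pos_right n hD₀
      omega) tendsto_id
  -- `n ≥ 108 D³` makes the bad mass at most `1/2`; `n ≥ 11 D` gives `2r + 1 ≤ n²`.
  filter_upwards [htend.eventually hrho', eventually_ge_atTop (108 * D ^ 3 + 11 * D),
    eventually_ge_atTop 3] with n hρ hnD h3
  have hDr : (1 : ℝ) ≤ D := by exact_mod_cast hD₀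
  have h3' : (3 : ℝ) ≤ n := by exact_mod_cast h3
  have hnD' : 108 * (D : ℝ) ^ 3 + 11 * D ≤ n := by exact_mod_cast hnD
  have hlog : 1 ≤ Real.log n := by
    rw [Real.le_log_iff_exp_le (by linarith)]
    exact (Real.exp_one_lt_d9.trans (by norm_num)).le.trans h3'
  have hlogn : Real.log n ≤ n := Real.log_le_self (by linarith)
  set ℓ := √((n : ℝ) * Real.log n) with hℓ
  have hℓ2 : ℓ ^ 2 = n * Real.log n := Real.sq_sqrt (by positivity)
  have hℓ1 : 1 ≤ ℓ := by
    rw [hℓ, Real.one_le_sqrt]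
    nlinarith
  have hℓn : ℓ ≤ n := by
    rw [hℓ, Real.sqrt_le_left (by linarith)]
    nlinarith
  -- The factor `4` makes the Gaussian term at most `n⁻⁸`, against a prefactor of order `n⁴` from
  -- times, words and sites.
  set r := ⌈4 * D * ℓ⌉₊ with hr
  have hr1 : 4 * D * ℓ ≤ r := Nat.le_ceil _
  have hr2 : (r : ℝ) ≤ 4 * D * ℓ + 1 := (Nat.ceil_lt_add_one (by positivity)).le
  have hexp : Real.exp (-((r : ℝ) ^ 2 / (2 * (D : ℝ) ^ 2 * n))) ≤ 1 / (n : ℝ) ^ 8 := by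
    have h1 : 8 * Real.log n ≤ (r : ℝ) ^ 2 / (2 * (D : ℝ) ^ 2 * n) := by
      rw [le_div_iff₀ (by positivity)]
      calc 8 * Real.log n * (2 * (D : ℝ) ^ 2 * n) = (4 * D * ℓ) ^ 2 := by
            rw [mul_pow, hℓ2]; ring
        _ ≤ (r : ℝ) ^ 2 := by gcongr
    calc _ ≤ Real.exp (-(8 * Real.log n)) := by gcongr
      _ = _ := by
        rw [Real.exp_neg, one_div, show (8 : ℝ) * Real.log n = (8 : ℕ) * Real.log n by norm_num,
          ← Real.log_pow, Real.exp_log (by positivity)]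
  have hbad : n * (Y.complexity (2 * (n * D) + 1) * ((2 * (n * D) + 1) *
      (2 * Real.exp (-((r : ℝ) ^ 2 / (2 * (D : ℝ) ^ 2 * n)))))) ≤ 1 / 2 := by
    push_cast at hρ
    have h1 : 2 * ((n : ℝ) * D) + 1 ≤ 3 * (n * D) := by nlinarith
    calc _ ≤ (n : ℝ) * ((3 * (n * D)) ^ 2 * ((3 * (n * D)) * (2 * (1 / (n : ℝ) ^ 8)))) := by
          have := hρ.trans (pow_le_pow_left₀ (by positivity) h1 2)
          gcongr
      _ = 54 * D ^ 3 / (n : ℝ) ^ 4 := by field_simp; norm_num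
      _ ≤ 1 / 2 := by
          rw [div_le_iff₀ (by positivity)]
          have : (n : ℝ) ≤ n ^ 4 := le_self_pow₀ (by linarith) (by norm_num)
          linarith
  have hmain := hper.one_le_mul_dotForm_walkLaw hw hD₀ hD hbad
  set ρ := Y.complexity ⌈(13 * D : ℝ) * ℓ⌉₊ with hρdef
  -- `2(r + D) + 1 ≤ 8Dℓ + 2D + 3 ≤ 13Dℓ`, as `D, ℓ ≥ 1`.
  have hle : 2 * (r + D) + 1 ≤ ⌈(13 * D : ℝ) * ℓ⌉₊ := by
    have : ((2 * (r + D) + 1 : ℕ) : ℝ) ≤ 13 * D * ℓ := by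
      push_cast
      nlinarith
    exact_mod_cast this.trans (Nat.le_ceil _)
  have hpow : (2 * (r : ℝ) + 1) ^ Y.complexity (2 * (r + D) + 1) ≤
      Real.exp (2 * ρ * Real.log n) := by
    have h1 : 2 * (r : ℝ) + 1 ≤ (n : ℝ) ^ 2 := by nlinarith [mul_le_mul hDr hℓn]
    calc _ ≤ ((n : ℝ) ^ 2) ^ Y.complexity (2 * (r + D) + 1) := by gcongr
      _ ≤ ((n : ℝ) ^ 2) ^ ρ :=
          pow_le_pow_right₀ (one_le_pow₀ (by linarith)) (complexity_mono hle)
      _ = _ := by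
          rw [← pow_mul, ← Real.exp_log (show (0 : ℝ) < n ^ (2 * ρ) by positivity), Real.log_pow]
          push_cast
          rfl
  have h0 := dotForm_self_nonneg (walkLaw w n)
  rw [neg_mul, neg_mul, Real.exp_neg, one_div_mul_eq_div, div_le_iff₀ (by norm_num),
    inv_le_iff_one_le_mul₀ (Real.exp_pos _)]
  refine hmain.trans ?_
  calc _ ≤ 4 * Real.exp (2 * ρ * Real.log n) * dotForm _ (walkLaw w n) (walkLaw w n) := by gcongr
    _ = _ := by ring

/-- The lower bound on return probabilities. -/
theorem exists_le_dotForm_walkLaw (hw : IsSymmWeight w)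
    (hrho : Tendsto (fun n : ℕ => (Real.log (n : ℝ) / (n : ℝ)) ^ 2 * (Y.complexity n : ℝ))
      atTop (𝓝 0)) :
    ∃ C₁ : ℝ, 0 < C₁ ∧ ∀ n : ℕ, 1 ≤ n →
      1 / C₁ * Real.exp (-C₁ * (Y.complexity ⌈C₁ * √((n : ℝ) * Real.log (n : ℝ))⌉₊ : ℝ)
          * Real.log (n : ℝ)) ≤ dotForm _ (walkLaw w n) (walkLaw w n) := by
  obtain ⟨D, hD₀, hD⟩ := hper.exists_window_and_abs_disp_le w.support
  obtain ⟨n₀, hn₀⟩ := eventually_atTop.1 (hper.eventually_le_dotForm_walkLaw hw hD₀ hD hrho)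
  have hpos (n : ℕ) := hw.dotForm_walkLaw_pos n
  -- `K` dominates each inverse norm at the finitely many times before `n₀`, where `1 / C` alone is
  -- a lower bound.
  set K := ∑ n ∈ Finset.range n₀, (dotForm _ (walkLaw w n) (walkLaw w n))⁻¹ with hK
  have hK0 : 0 ≤ K := Finset.sum_nonneg fun n _ => (inv_pos.2 (hpos n)).le
  have hDr : (1 : ℝ) ≤ D := by exact_mod_cast hD₀
  set C := 13 * D + K with hC
  have hC0 : 0 < C := by positivity
  refine ⟨C, hC0, fun n hn => ?_⟩
  have hlog : 0 ≤ Real.log n := Real.log_natCast_nonneg n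
  rcases lt_or_ge n n₀ with h | h
  · have h1 : (dotForm _ (walkLaw w n) (walkLaw w n))⁻¹ ≤ C := by
      have := Finset.single_le_sum
        (f := fun n => (dotForm _ (walkLaw w n) (walkLaw w n))⁻¹)
        (fun n _ => (inv_pos.2 (hpos n)).le) (Finset.mem_range.2 h)
      refine this.trans ?_
      rw [hC]
      linarith
    calc _ ≤ 1 / C * 1 := by
          gcongr
          rw [Real.exp_le_one_iff, neg_mul, neg_mul, neg_nonpos]
          positivity
      _ ≤ _ := by
          rw [mul_one, one_div]
          exact inv_le_of_inv_le₀ (hpos n) h1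
  · refine le_trans ?_ (hn₀ n h)
    have h1 : (Y.complexity ⌈(13 * D : ℝ) * √((n : ℝ) * Real.log (n : ℝ))⌉₊ : ℝ) ≤
        Y.complexity ⌈C * √((n : ℝ) * Real.log (n : ℝ))⌉₊ := by
      refine Nat.cast_le.2 (complexity_mono (Nat.ceil_mono ?_))
      have : (13 * D : ℝ) ≤ C := by linarith
      gcongr
    have h2 : (2 : ℝ) ≤ C := by linarith
    have h4 : (4 : ℝ) ≤ C := by linarith
    simp only [neg_mul]
    gcongr

end NoIsolatedPeriodicPoints

end SymbolicDynamics.FullShift.Subshift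

/-! ### Subgroups, the Følner function and the final exponents -/

section Pushforward

variable {G H : Type*} [Group G] [Group H] {w : G →₀ ℝ}

lemma dotForm_mapDomain_of_injective {Ω Ω' : Type*} {p : Ω → Ω'} (hp : Function.Injective p)
    (f g : Ω →₀ ℝ) : dotForm Ω' (f.mapDomain p) (g.mapDomain p) = dotForm Ω f g := by
  induction g using Finsupp.induction_linear with
  | zero => simp
  | add g₁ g₂ h₁ h₂ => rw [Finsupp.mapDomain_add, map_add, map_add, h₁, h₂]
  | single i a =>
    rw [Finsupp.mapDomain_single, dotForm_single_right, dotForm_single_right,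
      Finsupp.mapDomain_apply hp]

lemma IsSymmWeight.mapDomain (hw : IsSymmWeight w) {p : G →* H} (hp : Function.Injective p) :
    IsSymmWeight (w.mapDomain p) where
  nonneg s := by
    by_cases hs : s ∈ Set.range p
    · obtain ⟨g, rfl⟩ := hs
      rw [Finsupp.mapDomain_apply hp]
      exact hw.nonneg g
    · rw [Finsupp.mapDomain_of_notMem_range _ _ hs]
  sum_eq_one := by
    have h := Finsupp.sum_mapDomain_index (f := p) (s := w) (h := fun _ a => a) (fun _ => rfl)
      fun _ _ _ => rfl
    exact h.trans hw.sum_eq_one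
  inv s := by
    by_cases hs : s ∈ Set.range p
    · obtain ⟨g, rfl⟩ := hs
      rw [← map_inv, Finsupp.mapDomain_apply hp, Finsupp.mapDomain_apply hp, hw.inv]
    · rw [Finsupp.mapDomain_of_notMem_range _ _ hs, Finsupp.mapDomain_of_notMem_range]
      rintro ⟨g, hg⟩
      exact hs ⟨g⁻¹, by rw [map_inv, hg, inv_inv]⟩

/-- Lets a walk on a subgroup be studied in the full group; an injective `p` also preserves the
norms. -/
lemma walkLaw_mapDomain (p : G →* H) (n : ℕ) :
    walkLaw (w.mapDomain p) n = (walkLaw w n).mapDomain p := by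
  have h : walkOp (MulAction.toPermHom H H) (w.mapDomain p) =
      walkOp ((MulAction.toPermHom H H).comp p) w := by
    have h := Finsupp.sum_mapDomain_index (f := p) (s := w)
      (h := fun s a => a • Finsupp.lmapDomain ℝ ℝ (MulAction.toPermHom H H s))
      (fun _ => zero_smul _ _) fun _ _ _ => add_smul _ _ _
    exact h
  rw [walkLaw, walkLaw, h, walkOp_pow_mapDomain (φ' := (MulAction.toPermHom H H).comp p),
    Finsupp.mapDomain_single, map_one]
  exact fun g i => map_mul p g i

/-- The uniform distribution on `S ∪ {1}`. -/
lemma exists_isSymmWeight (S : Finset G) (hS : ∀ s ∈ S, s⁻¹ ∈ S) :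
    ∃ (w : G →₀ ℝ) (q : ℝ), IsSymmWeight w ∧ 0 < q ∧ q ≤ 1 ∧ q ≤ w 1 ∧ ∀ s ∈ S, q ≤ w s := by
  classical
  set T := insert 1 S with hT
  have hTpos : (0 : ℝ) < T.card := by
    exact_mod_cast Finset.card_pos.2 (Finset.insert_nonempty 1 S)
  have hTinv (s : G) : s⁻¹ ∈ T ↔ s ∈ T := by
    have key (s : G) (hs : s ∈ T) : s⁻¹ ∈ T := by
      rw [hT, Finset.mem_insert] at hs ⊢
      exact hs.imp (fun h => by rw [h, inv_one]) (hS s)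
    exact ⟨fun h => inv_inv s ▸ key _ h, key s⟩
  set w : G →₀ ℝ := Finsupp.indicator T fun _ _ => (T.card : ℝ)⁻¹ with hw
  have hwa (s : G) : w s = if s ∈ T then (T.card : ℝ)⁻¹ else 0 := by
    rw [hw, Finsupp.indicator_apply]
    split_ifs <;> rfl
  refine ⟨w, (T.card : ℝ)⁻¹, ⟨fun s => ?_, ?_, fun s => ?_⟩, by positivity, ?_, ?_, fun s hs => ?_⟩
  · rw [hwa]
    split_ifs <;> positivity
  · rw [Finset.sum_subset (Finsupp.support_indicator_subset T _) fun s _ hs =>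
      Finsupp.notMem_support_iff.1 hs, Finset.sum_congr rfl fun s hs => (hwa s).trans (if_pos hs),
      Finset.sum_const, nsmul_eq_mul, mul_inv_cancel₀ hTpos.ne']
  · rw [hwa, hwa]
    simp only [hTinv]
  · refine inv_le_one_of_one_le₀ ?_
    exact_mod_cast hTpos
  · rw [hwa, if_pos (Finset.mem_insert_self 1 S)]
  · rw [hwa, if_pos (Finset.mem_insert_of_mem hs)]

end Pushforward

section FoelnerBound

variable {G : Type*} [Group G] {w : G →₀ ℝ}

/-- Return probabilities that decay at most like `exp (-K * N ^ β)` bound the Følner function by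
`exp (C * n ^ (2 * β / (1 - β)))`. -/
theorem IsSymmWeight.exists_foelner_bound (hw : IsSymmWeight w) (S : Finset G) {q K β : ℝ}
    (hq : 0 < q) (hq1 : q ≤ 1) (h1 : q ≤ w 1) (hS : ∀ s ∈ S, q ≤ w s) (hK : 1 ≤ K) (hβ : 0 < β)
    (hβ1 : β < 1)
    (hret : ∀ N : ℕ, 1 ≤ N →
      Real.exp (-(K * (N : ℝ) ^ β)) ≤ dotForm G (walkLaw w N) (walkLaw w N)) :
    ∃ C₂ : ℝ, 0 < C₂ ∧ ∀ n : ℕ, 1 ≤ n → ∃ F : Finset G, F.Nonempty ∧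
      ((innerBoundary S F).card : ℝ) ≤ 1 / (n : ℝ) * (F.card : ℝ) ∧
      (F.card : ℝ) ≤ C₂ * Real.exp (C₂ * (n : ℝ) ^ (2 * β / (1 - β))) := by
  set d : ℝ := (S.card : ℝ) with hd
  have hd0 : 0 ≤ d := Nat.cast_nonneg _
  -- Chosen so that `δ = c / n²` and `l = 1 / (4(d + 1)n)` satisfy `8δ / q = 4l²`, while `4 d l ≤ 1
  -- / n`.
  set c : ℝ := q / (32 * (d + 1) ^ 2) with hc
  have hc0 : 0 < c := by positivity
  have hc1 : c ≤ 1 := by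
    rw [hc, div_le_one (by positivity)]
    nlinarith
  have hβ' : 0 < 1 - β := by linarith
  set B : ℝ := K * (2 ^ β * (K / c) ^ (β / (1 - β))) with hB
  have hB0 : 0 < B := by positivity
  refine ⟨4 + B, by positivity, fun n hn => ?_⟩
  have hn1 : (1 : ℝ) ≤ n := by exact_mod_cast hn
  have hn0 : (0 : ℝ) < n := by linarith
  set t : ℝ := K / c * (n : ℝ) ^ 2 with ht
  have ht1 : 1 ≤ t := by
    have h2 : 1 ≤ K / c := by rw [one_le_div hc0]; linarith
    exact one_le_mul_of_one_le_of_one_le h2 (one_le_pow₀ hn1)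
  -- Up to rounding, the least time with `K N^β ≤ δ N`, from which the return probability exceeds
  -- `(1 - δ)^N`.
  set N : ℕ := ⌈t ^ (1 / (1 - β))⌉₊ with hN
  have hx1 : 1 ≤ t ^ (1 / (1 - β)) := Real.one_le_rpow ht1 (by positivity)
  have hN1 : t ^ (1 / (1 - β)) ≤ N := Nat.le_ceil _
  have hN2 : (N : ℝ) ≤ 2 * t ^ (1 / (1 - β)) := by
    have := (Nat.ceil_lt_add_one (zero_le_one.trans hx1)).le
    linarith
  have hNpos : (0 : ℝ) < N := by linarith
  have hN0 : N ≠ 0 := by exact_mod_cast hNpos.ne'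
  have hpowN : K * (N : ℝ) ^ β ≤ c / (n : ℝ) ^ 2 * N := by
    have h2 : t ≤ (N : ℝ) ^ (1 - β) := by
      have := Real.rpow_le_rpow (by positivity) hN1 hβ'.le
      rwa [← Real.rpow_mul (by positivity), one_div_mul_cancel hβ'.ne', Real.rpow_one] at this
    have h3 : (N : ℝ) ^ (1 - β) * (N : ℝ) ^ β = N := by
      rw [← Real.rpow_add hNpos, sub_add_cancel, Real.rpow_one]
    have h4 : c / (n : ℝ) ^ 2 * t = K := by
      rw [ht]; field_simp
    calc K * (N : ℝ) ^ β = c / (n : ℝ) ^ 2 * t * (N : ℝ) ^ β := by rw [h4]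
      _ ≤ c / (n : ℝ) ^ 2 * (N : ℝ) ^ (1 - β) * (N : ℝ) ^ β := by gcongr
      _ = _ := by rw [mul_assoc, h3]
  have hδ1 : c / (n : ℝ) ^ 2 ≤ 1 := by
    rw [div_le_one (by positivity)]
    exact hc1.trans (one_le_pow₀ hn1)
  set l : ℝ := 1 / (4 * (d + 1) * n) with hl
  have hδl : 8 * (c / (n : ℝ) ^ 2) / q = 4 * l ^ 2 := by
    rw [hl, hc, div_pow, mul_pow, mul_pow]
    have hd1 : d + 1 ≠ 0 := by positivity
    clear_value d N t
    field_simp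
    norm_num
  have hret' : (1 - c / (n : ℝ) ^ 2) ^ N ≤ dotForm G (walkLaw w N) (walkLaw w N) := by
    refine le_trans ?_ (hret N (Nat.one_le_iff_ne_zero.2 hN0))
    calc (1 - c / (n : ℝ) ^ 2) ^ N ≤ Real.exp (-(c / (n : ℝ) ^ 2)) ^ N :=
          pow_le_pow_left₀ (by linarith) (Real.one_sub_le_exp_neg _) N
      _ = Real.exp (-(c / (n : ℝ) ^ 2 * N)) := by
          rw [← Real.exp_nat_mul]; congr 1; ring
      _ ≤ _ := by gcongr
  obtain ⟨F, hF, hcard, hbd⟩ := hw.exists_foelner_set S (l := l) hq h1 hS hδ1 (by positivity)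
    (le_of_eq hδl) hN0 hret'
  refine ⟨F, hF, hbd.trans ?_, ?_⟩
  · gcongr
    rw [hl, ← hd, show d * (4 * (1 / (4 * (d + 1) * n))) = d / ((d + 1) * n) by field_simp,
      div_le_div_iff₀ (by positivity) hn0]
    nlinarith
  · have hNβ : K * (N : ℝ) ^ β ≤ B * (n : ℝ) ^ (2 * β / (1 - β)) := by
      have h2 : (N : ℝ) ^ β ≤ (2 * t ^ (1 / (1 - β))) ^ β := by gcongr
      rw [Real.mul_rpow (by norm_num) (by positivity), ← Real.rpow_mul (by positivity), ht,
        Real.mul_rpow (by positivity) (by positivity), ← Real.rpow_natCast (n : ℝ) 2,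
        ← Real.rpow_mul hn0.le, one_div_mul_eq_div, Nat.cast_ofNat, ← mul_div_assoc] at h2
      calc _ ≤ K * _ := mul_le_mul_of_nonneg_left h2 (by linarith)
        _ = _ := by rw [hB]; ring
    have h3 : (F.card : ℝ) * Real.exp (-(K * (N : ℝ) ^ β)) ≤ 4 :=
      (mul_le_mul_of_nonneg_left (hret N (Nat.one_le_iff_ne_zero.2 hN0))
        (Nat.cast_nonneg _)).trans hcard
    rw [Real.exp_neg, ← div_eq_mul_inv, div_le_iff₀ (Real.exp_pos _)] at h3
    have h4 : 0 ≤ (n : ℝ) ^ (2 * β / (1 - β)) := by positivity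
    refine h3.trans (mul_le_mul (by linarith) (Real.exp_le_exp.2 (hNβ.trans ?_))
      (Real.exp_pos _).le (by positivity))
    gcongr
    linarith

end FoelnerBound

/-- Simplification of the lower bound for the return probability under a polynomial bound on the
complexity. -/
lemma exists_exp_neg_le_of_polynomial_growth {ρ : ℕ → ℕ} (hmono : Monotone ρ) {a : ℕ → ℝ}
    {C α C₁ σ : ℝ} (hC : 0 < C) (hα : 0 ≤ α) (hα2 : α < 2) (hC₁ : 0 < C₁) (hσ : 0 < σ)
    (hρ : ∀ n : ℕ, 1 ≤ n → (ρ n : ℝ) ≤ C * (n : ℝ) ^ α)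
    (ha : ∀ n : ℕ, 1 ≤ n → 1 / C₁ * Real.exp (-C₁ * (ρ ⌈C₁ * √((n : ℝ) * Real.log (n : ℝ))⌉₊ : ℝ)
      * Real.log (n : ℝ)) ≤ a n) :
    ∃ K : ℝ, 1 ≤ K ∧ ∀ n : ℕ, 1 ≤ n → Real.exp (-(K * (n : ℝ) ^ (α / 2 + 2 * σ))) ≤ a n := by
  -- From `log n ≤ n^σ / σ`; the `2` absorbs the ceiling and the shift to `m + 1`.
  set M : ℝ := C₁ * √(1 / σ) + 2 with hM
  have hM0 : 0 < M := by positivity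
  set K : ℝ := 1 + |Real.log C₁| + C₁ * (C * M ^ α) * (1 / σ) with hK
  have hK1 : 1 ≤ K := by
    have : 0 ≤ C₁ * (C * M ^ α) * (1 / σ) := by positivity
    have := abs_nonneg (Real.log C₁)
    linarith
  refine ⟨K, hK1, fun n hn => le_trans ?_ (ha n hn)⟩
  have hn1 : (1 : ℝ) ≤ n := by exact_mod_cast hn
  have hn0 : (0 : ℝ) < n := by linarith
  have hlog0 : 0 ≤ Real.log n := Real.log_nonneg hn1
  have hlog : Real.log n ≤ 1 / σ * (n : ℝ) ^ σ := by
    rw [one_div_mul_eq_div]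
    exact Real.log_le_rpow_div hn0.le hσ
  have hroot : √((n : ℝ) * Real.log n) ≤ √(1 / σ) * (n : ℝ) ^ ((1 + σ) / 2) := by
    rw [Real.sqrt_le_left (by positivity), mul_pow, Real.sq_sqrt (by positivity),
      ← Real.rpow_natCast ((n : ℝ) ^ _), ← Real.rpow_mul hn0.le]
    calc (n : ℝ) * Real.log n ≤ n * (1 / σ * (n : ℝ) ^ σ) := by gcongr
      _ = 1 / σ * (n : ℝ) ^ (1 + σ) := by rw [Real.rpow_add hn0, Real.rpow_one]; ring
      _ = _ := by
        congr 2
        push_cast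
        ring
  set m := ⌈C₁ * √((n : ℝ) * Real.log n)⌉₊ with hm
  have hm1 : ((m + 1 : ℕ) : ℝ) ≤ M * (n : ℝ) ^ ((1 + σ) / 2) := by
    have h1 : (m : ℝ) ≤ C₁ * √((n : ℝ) * Real.log n) + 1 := (Nat.ceil_lt_add_one (by positivity)).le
    have h2 : 1 ≤ (n : ℝ) ^ ((1 + σ) / 2) := Real.one_le_rpow hn1 (by positivity)
    have h3 := mul_le_mul_of_nonneg_left hroot hC₁.le
    push_cast
    rw [hM]
    nlinarith
  have hρm : (ρ m : ℝ) ≤ C * (M ^ α * (n : ℝ) ^ ((1 + σ) / 2 * α)) := by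
    -- For `n = 1` the logarithm vanishes and `m = 0`, outside the range of the growth bound.
    calc (ρ m : ℝ) ≤ ρ (m + 1) := by exact_mod_cast hmono (Nat.le_succ m)
      _ ≤ C * ((m + 1 : ℕ) : ℝ) ^ α := hρ _ (by omega)
      _ ≤ C * (M * (n : ℝ) ^ ((1 + σ) / 2)) ^ α := by gcongr
      _ = _ := by rw [Real.mul_rpow hM0.le (by positivity), ← Real.rpow_mul hn0.le]
  have hprod : C₁ * (ρ m : ℝ) * Real.log n ≤
      C₁ * (C * M ^ α) * (1 / σ) * (n : ℝ) ^ (α / 2 + 2 * σ) := by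
    calc C₁ * (ρ m : ℝ) * Real.log n
        ≤ C₁ * (C * (M ^ α * (n : ℝ) ^ ((1 + σ) / 2 * α))) * (1 / σ * (n : ℝ) ^ σ) := by gcongr
      _ = C₁ * (C * M ^ α) * (1 / σ) * (n : ℝ) ^ ((1 + σ) / 2 * α + σ) := by
          rw [Real.rpow_add hn0]; ring
      -- `(1 + σ)α/2 + σ ≤ α/2 + 2σ` because `α < 2`.
      _ ≤ _ := by
          exact mul_le_mul_of_nonneg_left
            (Real.rpow_le_rpow_of_exponent_le hn1 (by nlinarith)) (by positivity)
  have hpow1 : 1 ≤ (n : ℝ) ^ (α / 2 + 2 * σ) := Real.one_le_rpow hn1 (by positivity)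
  have hlogC : Real.log C₁ ≤ (1 + |Real.log C₁|) * (n : ℝ) ^ (α / 2 + 2 * σ) := by
    have h1 := le_abs_self (Real.log C₁)
    have h2 := abs_nonneg (Real.log C₁)
    nlinarith
  rw [one_div, ← Real.exp_log hC₁, ← Real.exp_neg, ← Real.exp_add, Real.exp_log hC₁,
    Real.exp_le_exp]
  have : K * (n : ℝ) ^ (α / 2 + 2 * σ) = (1 + |Real.log C₁|) * (n : ℝ) ^ (α / 2 + 2 * σ) +
      C₁ * (C * M ^ α) * (1 / σ) * (n : ℝ) ^ (α / 2 + 2 * σ) := by rw [hK]; ring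
  rw [this]
  linarith

/-- At `σ = 0` the left side equals `2α / (2 - α)`, and it is continuous there; `ε` pays for the
logarithms. -/
lemma exists_pos_exponent_le {α ε : ℝ} (hα : α < 2) (hε : 0 < ε) :
    ∃ σ : ℝ, 0 < σ ∧ α / 2 + 2 * σ < 1 ∧
      2 * (α / 2 + 2 * σ) / (1 - (α / 2 + 2 * σ)) ≤ 2 * α / (2 - α) + ε := by
  have h0 : 2 * (α / 2 + 2 * 0) / (1 - (α / 2 + 2 * 0)) < 2 * α / (2 - α) + ε := by
    have : 2 * (α / 2 + 2 * 0) / (1 - (α / 2 + 2 * 0)) = 2 * α / (2 - α) := by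
      have h1 : 2 - α ≠ 0 := by linarith
      have h2 : 1 - α / 2 ≠ 0 := by linarith
      rw [mul_zero, add_zero, div_eq_div_iff h2 h1]
      ring
    linarith
  have hc1 : ContinuousAt (fun σ : ℝ => 2 * (α / 2 + 2 * σ) / (1 - (α / 2 + 2 * σ))) 0 := by
    refine ContinuousAt.div (by fun_prop) (by fun_prop) ?_
    rw [mul_zero, add_zero]
    linarith
  have hc2 : ContinuousAt (fun σ : ℝ => α / 2 + 2 * σ) 0 := by fun_prop
  have e1 := hc1.eventually (eventually_lt_nhds h0)
  have e2 := hc2.eventually (eventually_lt_nhds (show α / 2 + 2 * 0 < 1 by linarith))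
  obtain ⟨σ, ⟨h1, h2⟩, h3⟩ := (((e1.and e2).filter_mono nhdsWithin_le_nhds).and
    (self_mem_nhdsWithin (s := Set.Ioi (0 : ℝ)))).exists
  exact ⟨σ, h3, h2, h1.le⟩

theorem corollary4 {A : Type*} [Finite A] [TopologicalSpace A] [DiscreteTopology A]
    (Y : Subshift A ℤ) (hper : Y.NoIsolatedPeriodicPoints)
    (hrho : Tendsto (fun n : ℕ => (Real.log (n : ℝ) / (n : ℝ)) ^ 2 * (Y.complexity n : ℝ))
      atTop (𝓝 0)) :
    (∀ μ : PMF (topologicalFullGroup Y.shiftHomeo),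
      μ.support.Finite → (∀ g, μ g⁻¹ = μ g) →
      ∃ C₁ : ℝ, 0 < C₁ ∧ ∀ n : ℕ, 1 ≤ n →
        1 / C₁ * Real.exp (-C₁ * (Y.complexity ⌈C₁ * √((n : ℝ) * Real.log (n : ℝ))⌉₊ : ℝ)
            * Real.log (n : ℝ))
          ≤ (convPower μ (2 * n) 1).toReal) ∧
    (∀ C α : ℝ, 0 < C → 1 ≤ α → α < 2 →
      (∀ n : ℕ, 1 ≤ n → (Y.complexity n : ℝ) ≤ C * (n : ℝ) ^ α) →
      ∀ (G : Subgroup (topologicalFullGroup Y.shiftHomeo)) (S : Finset G),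
        (∀ s ∈ S, s⁻¹ ∈ S) → Subgroup.closure (S : Set G) = ⊤ →
        ∀ ε : ℝ, 0 < ε → ∃ C₂ : ℝ, 0 < C₂ ∧ ∀ n : ℕ, 1 ≤ n →
          (foelnerCards S n).Nonempty ∧
          (foelnerFunction S n : ℝ)
            ≤ C₂ * Real.exp (C₂ * (n : ℝ) ^ (2 * α / (2 - α) + ε))) := by
  refine ⟨fun μ hμ hs => ?_, fun C α hC hα hα2 hgrowth G S hS _ ε hε => ?_⟩
  · obtain ⟨C₁, hC₁, h⟩ := hper.exists_le_dotForm_walkLaw (μ.isSymmWeight_toWeight hμ hs) hrho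
    refine ⟨C₁, hC₁, fun n hn => ?_⟩
    rw [convPower_two_mul_toReal μ hμ hs]
    exact h n hn
  · obtain ⟨w, q, hw, hq, hq1, hw1, hwS⟩ := exists_isSymmWeight S hS
    have hinj : Function.Injective G.subtype := G.subtype_injective
    obtain ⟨C₁, hC₁, h⟩ := hper.exists_le_dotForm_walkLaw (hw.mapDomain hinj) hrho
    simp only [walkLaw_mapDomain, dotForm_mapDomain_of_injective hinj] at h
    obtain ⟨σ, hσ, hβ1, hexp⟩ := exists_pos_exponent_le hα2 hε
    obtain ⟨K, hK, hret⟩ := exists_exp_neg_le_of_polynomial_growth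
      SymbolicDynamics.FullShift.Subshift.complexity_mono hC (by linarith) hα2 hC₁ hσ hgrowth h
    obtain ⟨C₂, hC₂, hF⟩ := hw.exists_foelner_bound S hq hq1 hw1 hwS hK (by linarith) hβ1 hret
    refine ⟨C₂, hC₂, fun n hn => ?_⟩
    obtain ⟨F, hFne, hbd, hcard⟩ := hF n hn
    have hmem : F.card ∈ foelnerCards S n := ⟨F, hFne, rfl, hbd⟩
    refine ⟨⟨_, hmem⟩, ?_⟩
    calc (foelnerFunction S n : ℝ) ≤ F.card := by exact_mod_cast Nat.sInf_le hmem
      _ ≤ _ := hcard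
      _ ≤ _ := by
        have : (1 : ℝ) ≤ n := by exact_mod_cast hn
        gcongr
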